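/- **Proposition (stochastic wave equation kernel, SWEK).** Let $G=(V,E)$ be a finite undirected graph with positive edge weights, let $L$ be its graph Laplacian $D_W-W$ or its symmetric normalized Laplacian $D_W^{-1/2}(D_W-W)D_W^{-1/2}$ (with $d^{-1/2}:=0$ at isolated vertices), let $\nu,\kappa>0$, and let $$\widetilde L=\Big(\tfrac{2\nu}{\kappa^2}I+L\Big)^{\nu/2},\qquad \Theta=c\sqrt{\widetilde L},$$ where $c\neq 0$ and functions of symmetric matrices are taken in the sense of the spectral calculus. Let $\sigma\in\mathbb R$, let $W$ be a standard $|V|$-dimensional Brownian motion on a probability space, and let $u(0),\dot u(0)\in\mathbb R^{V}$ be deterministic. Consider the second-order stochastic differential equation $$\frac{\mathrm d^2u}{\mathrm dt^2}=-c^2\widetilde L\,u+\sigma\dot W_t,\qquad t\ge 0,$$ understood as the system $\mathrm du=v\,\mathrm dt$, $\mathrm dv=-c^2\widetilde L u\,\mathrm dt+\sigma\,\mathrm dW_t$ in integrated form with continuous paths and $v(0)=\dot u(0)$. This equation has a solution, the solution is unique up to indistinguishability, and it is a Gaussian process with mean $$\mu(t)=\frac1c\,\widetilde L^{-1/2}\sin\!\big(c\sqrt{\widetilde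 L}\,t\big)\,\dot u(0)+\cos\!\big(c\sqrt{\widetilde L}\,t\big)\,u(0),$$ that is, for every diagonalization $\widetilde L=P^{-1}\widetilde L_dP$ with $\widetilde L_d$ diagonal, $$\mu(t)=P^{-1}\Big(\frac1c\,\widetilde L_d^{-1/2}\sin\!\big(c\sqrt{\widetilde L_d}\,t\big)P\dot u(0)+\cos\!\big(c\sqrt{\widetilde L_d}\,t\big)Pu(0)\Big),$$ and with covariance, for all $s,t\ge 0$, $$\operatorname{Cov}[u(s),u(t)]=\sigma^2\,\Theta^{-2}\Big(\tfrac12\min(t,s)\cos(\Theta(t-s))-\tfrac12\cos(\Theta\max(t,s))\,\sin(\Theta\min(t,s))\,\Theta^{-1}\Big).$$ -/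

import Mathlib

open MeasureTheory ProbabilityTheory
open scoped NNReal

noncomputable section

/-- A finite undirected weighted graph: a simple graph with symmetric edge weights, positive on the
edges and zero elsewhere. -/
structure WeightedGraph (V : Type*) where
  graph : SimpleGraph V
  weight : V → V → ℝ
  weight_symm : ∀ i j, weight i j = weight j i
  weight_pos : ∀ i j, graph.Adj i j → 0 < weight i j
  weight_zero : ∀ i j, ¬ graph.Adj i j → weight i j = 0

namespace WeightedGraph

variable {V : Type*} [Fintype V] [DecidableEq V]

/-- The accumulated weight `w_i = ∑_j w_ij` of a vertex. -/
def degree (G : WeightedGraph V) (i : V) : ℝ := ∑ j, G.weight i j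

/-- The graph Laplacian `L = D_W - W`. -/
def laplacian (G : WeightedGraph V) : Matrix V V ℝ :=
  Matrix.diagonal G.degree - Matrix.of G.weight

/-- The (symmetric) normalized graph Laplacian `D_W^{-1/2} L D_W^{-1/2}`, with the usual convention
that `d^{-1/2}` is `0` at an isolated vertex. Its diagonal entries are `1` at all other vertices. -/
def normalizedLaplacian (G : WeightedGraph V) : Matrix V V ℝ :=
  Matrix.diagonal (fun i => (Real.sqrt (G.degree i))⁻¹) * G.laplacian *
    Matrix.diagonal (fun i => (Real.sqrt (G.degree i))⁻¹)

/-- An unweighted graph, seen as a weighted graph with all edge weights equal to `1`. -/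
def ofSimpleGraph (G : SimpleGraph V) [DecidableRel G.Adj] : WeightedGraph V where
  graph := G
  weight i j := if G.Adj i j then 1 else 0
  weight_symm i j := by simp [G.adj_comm]
  weight_pos i j h := by simp [h]
  weight_zero i j h := by simp [h]

/-- In the unweighted case the Laplacian is Mathlib's Laplacian matrix. -/
theorem laplacian_ofSimpleGraph (G : SimpleGraph V) [DecidableRel G.Adj] :
    (ofSimpleGraph G).laplacian = G.lapMatrix ℝ := by
  have hd : (ofSimpleGraph G).degree = fun i => (G.degree i : ℝ) := by
    funext i
    simp [degree, ofSimpleGraph, ← SimpleGraph.card_neighborFinset_eq_degree,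
      SimpleGraph.neighborFinset_eq_filter]
  unfold laplacian SimpleGraph.lapMatrix SimpleGraph.degMatrix
  rw [hd]
  congr 1

end WeightedGraph

namespace SWEK

variable {V : Type*} [Fintype V] [DecidableEq V]

/-! Functions of a real symmetric matrix are given by the continuous functional calculus: `cfc f A`
has the eigenvectors of `A`, with each eigenvalue `x` replaced by `f x`. -/

/-- The fractional graph Laplacian `((2ν/κ²) I + L)^{ν/2}`. -/
def fracLaplacian (ν κ : ℝ) (L : Matrix V V ℝ) : Matrix V V ℝ :=
  cfc (fun x : ℝ => x ^ (ν / 2)) ((2 * ν / κ ^ 2) • (1 : Matrix V V ℝ) + L)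

/-- `Θ = c √A`. -/
def theta (c : ℝ) (A : Matrix V V ℝ) : Matrix V V ℝ := c • cfc Real.sqrt A

/-- The mean `(1/c) A^{-1/2} sin(Θ t) v₀ + cos(Θ t) u₀`, where `Θ = c √A`. -/
def mean (c : ℝ) (A : Matrix V V ℝ) (u₀ v₀ : EuclideanSpace ℝ V) (t : ℝ) : EuclideanSpace ℝ V :=
  Matrix.toEuclideanCLM (𝕜 := ℝ)
      ((1 / c) • (cfc (fun x : ℝ => x ^ (-(1 / 2) : ℝ)) A * cfc Real.sin (t • theta c A))) v₀ +
    Matrix.toEuclideanCLM (𝕜 := ℝ) (cfc Real.cos (t • theta c A)) u₀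

/-- The mean in the eigenbasis coordinates `y = U u`, transformed back: for `D = diag(lam)`,
`U⁻¹ ((1/c) D^{-1/2} sin(c √D t) U v₀ + cos(c √D t) U u₀)`. -/
def meanDiag (c : ℝ) (U : Matrix V V ℝ) (lam : V → ℝ) (u₀ v₀ : EuclideanSpace ℝ V) (t : ℝ) :
    EuclideanSpace ℝ V :=
  Matrix.toEuclideanCLM (𝕜 := ℝ) U⁻¹
    (Matrix.toEuclideanCLM (𝕜 := ℝ)
        ((1 / c) • (Matrix.diagonal (fun k => lam k ^ (-(1 / 2) : ℝ)) *
          Matrix.diagonal (fun k => Real.sin (c * Real.sqrt (lam k) * t)) * U)) v₀ +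
      Matrix.toEuclideanCLM (𝕜 := ℝ)
        (Matrix.diagonal (fun k => Real.cos (c * Real.sqrt (lam k) * t)) * U) u₀)

/-- The kernel
`σ² Θ⁻² (½ min(t,s) cos(Θ (t - s)) - ½ cos(Θ max(t,s)) sin(Θ min(t,s)) Θ⁻¹)`, `Θ = c √A`. -/
def kernel (c σ : ℝ) (A : Matrix V V ℝ) (s t : ℝ) : Matrix V V ℝ :=
  σ ^ 2 • ((theta c A)⁻¹ ^ 2 *
    ((1 / 2 * min t s : ℝ) • cfc Real.cos ((t - s) • theta c A) -
      (1 / 2 : ℝ) • (cfc Real.cos (max t s • theta c A) * cfc Real.sin (min t s • theta c A) *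
        (theta c A)⁻¹)))

variable {Ω : Type*} [MeasurableSpace Ω]

/-- `|V|`-dimensional standard Brownian motion: the coordinates are independent real Brownian
motions. -/
structure IsBrownian (W : ℝ≥0 → Ω → EuclideanSpace ℝ V) (P : Measure Ω) : Prop where
  coord : ∀ i, IsBrownianReal (fun t ω => W t ω i) P
  indep : iIndepFun (fun (i : V) (ω : Ω) (t : ℝ≥0) => W t ω i) P

/-- `u` solves `d²u/dt² = -c² A u + σ dW/dt`, `u(0) = u₀`, `u'(0) = v₀`. As usual this means that
`du = v dt`, `dv = -c² A u dt + σ dW` for some velocity process `v`, in integrated form, along almost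
every path. The noise is additive, so only Lebesgue integrals of continuous paths occur. -/
def IsSolution (c σ : ℝ) (A : Matrix V V ℝ) (W : ℝ≥0 → Ω → EuclideanSpace ℝ V)
    (u₀ v₀ : EuclideanSpace ℝ V) (P : Measure Ω) (u : ℝ≥0 → Ω → EuclideanSpace ℝ V) : Prop :=
  ∃ v : ℝ≥0 → Ω → EuclideanSpace ℝ V, ∀ᵐ ω ∂P,
    Continuous (fun t => u t ω) ∧ Continuous (fun t => v t ω) ∧
    ∀ t : ℝ≥0,
      u t ω = u₀ + ∫ r in (0 : ℝ)..t, v r.toNNReal ω ∧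
      v t ω = v₀ + (∫ r in (0 : ℝ)..t,
        -(c ^ 2) • Matrix.toEuclideanCLM (𝕜 := ℝ) A (u r.toNNReal ω)) + σ • W t ω

end SWEK

end

/-!
Diagonalize `Ã = fracLaplacian ν κ L`. Since `L` is positive semidefinite and `2ν/κ² > 0`, there is
an orthogonal `U` with `Ã = Uᵀ diag(lam) U` and `lam > 0`. The noise is additive, so the equation
can be solved path by path: in the coordinates `y = U u` it decouples into forced scalar oscillators
`y'' = -θ² y + σ ḃ` with `θ = c √lam ≠ 0`. Integration by parts turns the stochastic convolution
`∫₀ᵗ θ⁻¹ sin(θ (t - r)) db(r)` into the ordinary integral `∫₀ᵗ cos(θ (t - r)) b(r) dr`, which makes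
sense for every continuous `b`. The resulting variation of constants formula solves the equation
(`exists_oscillator`), and every solution is given by it (`oscillator_eq`, `pathSolution_eq`); this
is existence and uniqueness. It also shows that almost surely, for all `t ≤ T`, the vector `u(t)` is
the stated mean plus a linear combination of integrals `∫₀ᵀ d(r) W_j(r) dr` with deterministic `d`.

Such integrals are Wiener integrals `∫₀ᵀ D dW_j` of the primitives `D(x) = ∫ₓᵀ d`. By Abel summation
they are almost sure limits of `∑ᵢ D(rᵢ) (W_j(rᵢ₊₁) - W_j(rᵢ))`, which are centred Gaussian with
variance a Riemann sum of `∫₀ᵀ D²`; characteristic functions pass this to the limit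
(`IsBrownian.hasLaw_integral`). Applied to all linear functionals of finitely many values `u(t)` it
shows that `u` is a Gaussian process, and by polarization it gives the covariance
(`IsBrownian.covariance_integral`). Here `D(x) = σ Θ⁻¹ sin(Θ (t - x)⁺)`, so the covariance of `u(s)`
and `u(t)` is `σ² Θ⁻² ∫₀^{min(s,t)} sin(Θ (s - x)) sin(Θ (t - x)) dx`, an elementary integral
(`integral_sin_mul_sin`).

Formulas in the spectral calculus are compared with formulas in coordinates through
`cfc_eq_conjDiag`, which holds for every diagonalization, orthogonal or not.
-/

namespace SWEK

/-! ### Spectral calculus of a diagonalized matrix -/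

section LinearAlgebra

open Matrix

variable {V : Type*} [Fintype V] [DecidableEq V]

/-- The matrix `U⁻¹ diag(f) U`, diagonal with entries `f` in the coordinates `y = U u`. -/
noncomputable def conjDiag (U : Matrix V V ℝ) (f : V → ℝ) : Matrix V V ℝ :=
  U⁻¹ * diagonal f * U

lemma conjDiag_mul {U : Matrix V V ℝ} (hU : IsUnit U) (f g : V → ℝ) :
    conjDiag U f * conjDiag U g = conjDiag U (fun k => f k * g k) := by
  have h : U * U⁻¹ = 1 := mul_nonsing_inv _ ((isUnit_iff_isUnit_det _).1 hU)
  unfold conjDiag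
  rw [← diagonal_mul_diagonal]
  calc U⁻¹ * diagonal f * U * (U⁻¹ * diagonal g * U)
      = U⁻¹ * diagonal f * (U * U⁻¹) * diagonal g * U := by simp only [Matrix.mul_assoc]
    _ = _ := by rw [h]; simp only [Matrix.mul_assoc, Matrix.one_mul]

lemma conjDiag_one {U : Matrix V V ℝ} (hU : IsUnit U) : conjDiag U (fun _ => 1) = 1 := by
  simp [conjDiag, diagonal_one, nonsing_inv_mul _ ((isUnit_iff_isUnit_det _).1 hU)]

lemma smul_conjDiag (U : Matrix V V ℝ) (a : ℝ) (f : V → ℝ) :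
    a • conjDiag U f = conjDiag U (fun k => a * f k) := by
  have : (diagonal fun k => a * f k) = a • diagonal f := by
    rw [← diagonal_smul]; rfl
  simp [conjDiag, this]

lemma conjDiag_sub (U : Matrix V V ℝ) (f g : V → ℝ) :
    conjDiag U f - conjDiag U g = conjDiag U (fun k => f k - g k) := by
  simp [conjDiag, ← diagonal_sub, Matrix.mul_sub, Matrix.sub_mul]

lemma inv_conjDiag {U : Matrix V V ℝ} (hU : IsUnit U) {f : V → ℝ} (hf : ∀ k, f k ≠ 0) :
    (conjDiag U f)⁻¹ = conjDiag U (fun k => (f k)⁻¹) := by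
  apply inv_eq_right_inv
  simp [conjDiag_mul hU, hf, conjDiag_one hU]

/-- The continuous functional calculus may be computed in any diagonalization, not only in an
orthogonal one: on the finitely many points that matter, the function is a polynomial. -/
lemma cfc_eq_conjDiag {U A : Matrix V V ℝ} (hU : IsUnit U) {lam : V → ℝ} (hA : IsSelfAdjoint A)
    (h : A = conjDiag U lam) (f : ℝ → ℝ) : cfc f A = conjDiag U (fun k => f (lam k)) := by
  classical
  set S : Finset ℝ := (finite_real_spectrum (A := A)).toFinset ∪ Finset.univ.image lam with hS
  set q : Polynomial ℝ := Lagrange.interpolate S id f with hq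
  have hqf : ∀ x ∈ S, q.eval x = f x := fun x hx =>
    Lagrange.eval_interpolate_at_node (v := id) f (Function.injective_id.injOn) hx
  have h1 : cfc f A = cfc (fun x => q.eval x) A :=
    cfc_congr fun x hx => (hqf x (by simp [hS, hx])).symm
  have h2 : (fun k => f (lam k)) = fun k => q.eval (lam k) :=
    funext fun k => (hqf _ (by simp [hS])).symm
  rw [h1, cfc_polynomial q A hA, h2, h]
  induction q using Polynomial.induction_on' with
  | add p r hp hr =>
    rw [map_add, hp, hr]
    simp [conjDiag, ← diagonal_add, Matrix.mul_add, Matrix.add_mul]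
  | monomial n a =>
    have hpow : ∀ n : ℕ, conjDiag U lam ^ n = conjDiag U (fun k => lam k ^ n) := by
      intro n
      induction n with
      | zero => simp [conjDiag_one hU]
      | succ n ih => rw [pow_succ, ih, conjDiag_mul hU]; simp [pow_succ]
    simp [Polynomial.aeval_monomial, hpow, ← Algebra.smul_def, smul_conjDiag]

lemma theta_eq_conjDiag {U A : Matrix V V ℝ} (hU : IsUnit U) {lam : V → ℝ} (hA : IsSelfAdjoint A)
    (h : A = conjDiag U lam) (c : ℝ) : theta c A = conjDiag U (fun k => c * √(lam k)) := by
  rw [theta, cfc_eq_conjDiag hU hA h, smul_conjDiag]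

lemma cfc_smul_theta {U A : Matrix V V ℝ} (hU : IsUnit U) {lam : V → ℝ} (hA : IsSelfAdjoint A)
    (h : A = conjDiag U lam) (c t : ℝ) (f : ℝ → ℝ) :
    cfc f (t • theta c A) = conjDiag U (fun k => f (t * (c * √(lam k)))) := by
  refine cfc_eq_conjDiag hU ?_ ?_ f
  · exact IsSelfAdjoint.smul (.all t) (IsSelfAdjoint.smul (.all c) (cfc_predicate Real.sqrt A))
  · rw [theta_eq_conjDiag hU hA h, smul_conjDiag]

lemma mean_eq_conjDiag {U A : Matrix V V ℝ} (hU : IsUnit U) {lam : V → ℝ} (hA : IsSelfAdjoint A)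
    (h : A = conjDiag U lam) (c : ℝ) (u₀ v₀ : EuclideanSpace ℝ V) (t : ℝ) :
    mean c A u₀ v₀ t =
      toEuclideanCLM (𝕜 := ℝ) (conjDiag U fun k =>
        1 / c * (lam k ^ (-(1 / 2) : ℝ) * Real.sin (t * (c * √(lam k))))) v₀ +
      toEuclideanCLM (𝕜 := ℝ) (conjDiag U fun k => Real.cos (t * (c * √(lam k)))) u₀ := by
  rw [mean, cfc_smul_theta hU hA h, cfc_smul_theta hU hA h, cfc_eq_conjDiag hU hA h,
    conjDiag_mul hU, smul_conjDiag]

lemma mean_eq_meanDiag {U A : Matrix V V ℝ} (hU : IsUnit U) {lam : V → ℝ} (hA : IsSelfAdjoint A)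
    (h : A = conjDiag U lam) (c : ℝ) (u₀ v₀ : EuclideanSpace ℝ V) (t : ℝ) :
    mean c A u₀ v₀ t = meanDiag c U lam u₀ v₀ t := by
  have hc : ∀ k, t * (c * √(lam k)) = c * √(lam k) * t := fun k => by ring
  rw [mean_eq_conjDiag hU hA h, ← smul_conjDiag, meanDiag, map_add]
  simp_rw [hc]
  simp only [← mul_apply_eq_comp, ← map_mul, conjDiag, Matrix.mul_smul,
    ← diagonal_mul_diagonal, Matrix.mul_assoc]

lemma kernel_eq_conjDiag {U A : Matrix V V ℝ} (hU : IsUnit U) {lam : V → ℝ} (hA : IsSelfAdjoint A)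
    (h : A = conjDiag U lam) {c : ℝ} (hθ : ∀ k, c * √(lam k) ≠ 0) (σ s t : ℝ) :
    kernel c σ A s t = conjDiag U (fun k => σ ^ 2 * ((c * √(lam k))⁻¹ ^ 2 *
      (1 / 2 * min t s * Real.cos ((t - s) * (c * √(lam k))) -
        1 / 2 * (Real.cos (max t s * (c * √(lam k))) * Real.sin (min t s * (c * √(lam k))) *
          (c * √(lam k))⁻¹)))) := by
  rw [kernel, cfc_smul_theta hU hA h, cfc_smul_theta hU hA h, cfc_smul_theta hU hA h,
    theta_eq_conjDiag hU hA h, inv_conjDiag hU hθ]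
  simp only [pow_two, conjDiag_mul hU, smul_conjDiag, conjDiag_sub]

/-! ### The fractional Laplacian is positive definite -/

lemma posSemidef_laplacian (G : WeightedGraph V) : G.laplacian.PosSemidef := by
  have hw : ∀ i j, 0 ≤ G.weight i j := fun i j => by
    by_cases h : G.graph.Adj i j
    · exact (G.weight_pos i j h).le
    · exact (G.weight_zero i j h).ge
  refine .of_dotProduct_mulVec_nonneg ?_ fun x => ?_
  · refine (isHermitian_diagonal _).sub ?_
    ext i j
    simp [G.weight_symm]
  · have h1 : star x ⬝ᵥ (G.laplacian *ᵥ x)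
        = ∑ i, ∑ j, G.weight i j * (x i * x i) - ∑ i, ∑ j, G.weight i j * (x i * x j) := by
      rw [WeightedGraph.laplacian, sub_mulVec, dotProduct_sub]
      congr 1
      · simp only [dotProduct, mulVec_diagonal, WeightedGraph.degree, Finset.sum_mul,
          Finset.mul_sum, star_trivial]
        exact Finset.sum_congr rfl fun i _ => Finset.sum_congr rfl fun j _ => by ring
      · simp only [dotProduct, mulVec, Finset.mul_sum, star_trivial, of_apply]
        exact Finset.sum_congr rfl fun i _ => Finset.sum_congr rfl fun j _ => by ring
    have h2 : ∑ i, ∑ j, G.weight i j * (x i * x i) = ∑ i, ∑ j, G.weight i j * (x j * x j) := by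
      rw [Finset.sum_comm]
      exact Finset.sum_congr rfl fun i _ => Finset.sum_congr rfl fun j _ => by
        rw [G.weight_symm]
    -- The Dirichlet form: `2 xᵀ L x = ∑ w_ij (x_i - x_j)²`.
    have h3 : 0 ≤ ∑ i, ∑ j, G.weight i j * (x i - x j) ^ 2 :=
      Finset.sum_nonneg fun i _ => Finset.sum_nonneg fun j _ => mul_nonneg (hw i j) (sq_nonneg _)
    have h4 : ∑ i, ∑ j, G.weight i j * (x i - x j) ^ 2
        = ∑ i, ∑ j, G.weight i j * (x i * x i) + ∑ i, ∑ j, G.weight i j * (x j * x j)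
          - 2 * ∑ i, ∑ j, G.weight i j * (x i * x j) := by
      simp only [Finset.mul_sum, ← Finset.sum_add_distrib, ← Finset.sum_sub_distrib]
      exact Finset.sum_congr rfl fun i _ => Finset.sum_congr rfl fun j _ => by ring
    rw [h1]
    linarith

lemma posSemidef_normalizedLaplacian (G : WeightedGraph V) : G.normalizedLaplacian.PosSemidef := by
  simpa [WeightedGraph.normalizedLaplacian] using
    (posSemidef_laplacian G).mul_mul_conjTranspose_same
      (diagonal fun i => (√(G.degree i))⁻¹)

/-- The spectral theorem in the form needed here: the rows of `U` are an orthonormal eigenbasis of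
the fractional Laplacian, whose eigenvalues are positive because the shift `2ν/κ²` is. -/
lemma exists_diagonalization_fracLaplacian {L : Matrix V V ℝ} (hL : L.PosSemidef) {ν κ : ℝ}
    (hν : 0 < ν) (hκ : 0 < κ) :
    IsSelfAdjoint (fracLaplacian ν κ L) ∧ ∃ (U : Matrix V V ℝ) (lam : V → ℝ),
      Uᵀ * U = 1 ∧ U * Uᵀ = 1 ∧ (∀ k, 0 < lam k) ∧ fracLaplacian ν κ L = conjDiag U lam := by
  refine ⟨cfc_predicate _ _, ?_⟩
  have hM : ((2 * ν / κ ^ 2) • (1 : Matrix V V ℝ) + L).PosDef :=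
    (PosDef.one.smul (by positivity : 0 < 2 * ν / κ ^ 2)).add_posSemidef hL
  set M := (2 * ν / κ ^ 2) • (1 : Matrix V V ℝ) + L with hMdef
  set Q : Matrix V V ℝ := (hM.isHermitian.eigenvectorUnitary : Matrix V V ℝ) with hQ
  have hQ1 : Qᵀ * Q = 1 := by
    have := Unitary.coe_star_mul_self hM.isHermitian.eigenvectorUnitary
    rwa [star_eq_conjTranspose, conjTranspose_eq_transpose_of_trivial] at this
  have hQ2 : Q * Qᵀ = 1 := mul_eq_one_comm.1 hQ1
  have hinv : (Qᵀ)⁻¹ = Q := inv_eq_right_inv hQ1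
  have hunit : IsUnit Qᵀ := IsUnit.of_mul_eq_one _ hQ1
  refine ⟨Qᵀ, fun k => hM.isHermitian.eigenvalues k ^ (ν / 2), by simpa using hQ2,
    by simpa using hQ1, fun k => Real.rpow_pos_of_pos (hM.eigenvalues_pos k) _, ?_⟩
  refine cfc_eq_conjDiag hunit hM.isHermitian.isSelfAdjoint ?_ _
  have := hM.isHermitian.spectral_theorem
  rw [Unitary.conjStarAlgAut_apply, star_eq_conjTranspose,
    conjTranspose_eq_transpose_of_trivial] at this
  rw [conjDiag, hinv]
  exact this

end LinearAlgebra

end SWEK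

namespace SWEK

/-! ### The forced scalar oscillator -/

/-- Variation of constants for `y'' = -θ² y + σ ḃ` with a forcing `b` that need not be
differentiable: an integration by parts has moved the derivative from `b` onto the propagator
`θ⁻¹ sin (θ (t - r))`. -/
lemma oscillator_eq {θ σ y₀ z₀ : ℝ} (hθ : θ ≠ 0) {y z b : ℝ≥0 → ℝ} (hy : Continuous y)
    (hz : Continuous z) (hb : Continuous b)
    (h1 : ∀ t : ℝ≥0, y t = y₀ + ∫ r in (0 : ℝ)..t, z r.toNNReal)
    (h2 : ∀ t : ℝ≥0, z t = z₀ + (∫ r in (0 : ℝ)..t, -θ ^ 2 * y r.toNNReal) + σ * b t) (t : ℝ≥0) :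
    y t = Real.cos (t * θ) * y₀ + Real.sin (t * θ) / θ * z₀ +
      σ * ∫ r in (0 : ℝ)..t, b r.toNNReal * Real.cos ((t - r) * θ) := by
  set Y : ℝ → ℝ := fun s => y₀ + ∫ r in (0 : ℝ)..s, z r.toNNReal with hY
  -- `p = z - σ b` is differentiable although `z` and `b` are not.
  set p : ℝ → ℝ := fun s => z₀ + ∫ r in (0 : ℝ)..s, -θ ^ 2 * y r.toNNReal with hp
  have hyc : Continuous fun r : ℝ => -θ ^ 2 * y r.toNNReal := by fun_prop
  have hzc : Continuous fun r : ℝ => z r.toNNReal := by fun_prop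
  have hY' : ∀ s, HasDerivAt Y (z s.toNNReal) s := fun s =>
    ((hzc.integral_hasStrictDerivAt 0 s).hasDerivAt).const_add y₀
  have hp' : ∀ s, HasDerivAt p (-θ ^ 2 * y s.toNNReal) s := fun s =>
    ((hyc.integral_hasStrictDerivAt 0 s).hasDerivAt).const_add z₀
  have hYy : ∀ s : ℝ, 0 ≤ s → Y s = y s.toNNReal := fun s hs => by
    rw [h1, Real.coe_toNNReal s hs]
  have hpz : ∀ s : ℝ, 0 ≤ s → z s.toNNReal = p s + σ * b s.toNNReal := fun s hs => by
    rw [h2, Real.coe_toNNReal s hs]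
  have key : ∀ s ∈ Set.uIcc (0 : ℝ) t, HasDerivAt
      (fun s => Real.cos ((t - s) * θ) * Y s + Real.sin ((t - s) * θ) / θ * p s)
      (σ * (b s.toNNReal * Real.cos ((t - s) * θ))) s := by
    intro s hs
    rw [Set.uIcc_of_le t.coe_nonneg] at hs
    have hl : HasDerivAt (fun s : ℝ => ((t : ℝ) - s) * θ) (-1 * θ) s :=
      ((hasDerivAt_id s).const_sub (t : ℝ)).mul_const θ
    have := (hl.cos.mul (hY' s)).add ((hl.sin.div_const θ).mul (hp' s))
    refine this.congr_deriv ?_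
    rw [hpz s hs.1, hYy s hs.1]
    field_simp
    ring
  have hint := intervalIntegral.integral_eq_sub_of_hasDerivAt key
    (Continuous.intervalIntegrable (by fun_prop) _ _)
  rw [intervalIntegral.integral_const_mul] at hint
  rw [hint, hYy t t.coe_nonneg]
  simp [hY, hp]

/-- The variation of constants formula does solve the forced oscillator equation. -/
lemma exists_oscillator {θ : ℝ} (hθ : θ ≠ 0) (σ y₀ z₀ : ℝ) {b : ℝ≥0 → ℝ} (hb : Continuous b) :
    ∃ y z : ℝ≥0 → ℝ, Continuous y ∧ Continuous z ∧
      (∀ t : ℝ≥0, y t = y₀ + ∫ r in (0 : ℝ)..t, z r.toNNReal) ∧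
      ∀ t : ℝ≥0, z t = z₀ + (∫ r in (0 : ℝ)..t, -θ ^ 2 * y r.toNNReal) + σ * b t := by
  -- The addition theorem splits the convolution integral into `C` and `S`.
  set C : ℝ → ℝ := fun s => ∫ r in (0 : ℝ)..s, b r.toNNReal * Real.cos (r * θ) with hC
  set S : ℝ → ℝ := fun s => ∫ r in (0 : ℝ)..s, b r.toNNReal * Real.sin (r * θ) with hS
  have hC' : ∀ s, HasDerivAt C (b s.toNNReal * Real.cos (s * θ)) s := fun s =>
    (Continuous.integral_hasStrictDerivAt (by fun_prop) 0 s).hasDerivAt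
  have hS' : ∀ s, HasDerivAt S (b s.toNNReal * Real.sin (s * θ)) s := fun s =>
    (Continuous.integral_hasStrictDerivAt (by fun_prop) 0 s).hasDerivAt
  set Y : ℝ → ℝ := fun s => Real.cos (s * θ) * (y₀ + σ * C s) +
    Real.sin (s * θ) * (z₀ / θ + σ * S s) with hY
  set p : ℝ → ℝ := fun s => -θ * Real.sin (s * θ) * (y₀ + σ * C s) +
    θ * Real.cos (s * θ) * (z₀ / θ + σ * S s) with hp
  have hl : ∀ s : ℝ, HasDerivAt (fun s : ℝ => s * θ) (1 * θ) s := fun s =>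
    (hasDerivAt_id s).mul_const θ
  have hY' : ∀ s, HasDerivAt Y (p s + σ * b s.toNNReal) s := fun s => by
    have := ((hl s).cos.mul (((hC' s).const_mul σ).const_add y₀)).add
      ((hl s).sin.mul (((hS' s).const_mul σ).const_add (z₀ / θ)))
    refine this.congr_deriv ?_
    simp only [hp]
    linear_combination σ * b s.toNNReal * Real.sin_sq_add_cos_sq (s * θ)
  have hp' : ∀ s, HasDerivAt p (-θ ^ 2 * Y s) s := fun s => by
    have := (((hl s).sin.const_mul (-θ)).mul (((hC' s).const_mul σ).const_add y₀)).add
      (((hl s).cos.const_mul θ).mul (((hS' s).const_mul σ).const_add (z₀ / θ)))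
    refine this.congr_deriv ?_
    simp only [hY]
    ring
  have hYc : Continuous Y := continuous_iff_continuousAt.2 fun s => (hY' s).continuousAt
  have hpc : Continuous p := continuous_iff_continuousAt.2 fun s => (hp' s).continuousAt
  refine ⟨fun t => Y t, fun t => p t + σ * b t, by fun_prop, by fun_prop, fun t => ?_,
    fun t => ?_⟩
  · have := intervalIntegral.integral_eq_sub_of_hasDerivAt (a := 0) (b := t) (fun s _ => hY' s)
      (Continuous.intervalIntegrable (by fun_prop) _ _)
    have h0 : Y 0 = y₀ := by simp [hY, hC]
    have hc : ∫ r in (0 : ℝ)..t, (p r.toNNReal + σ * b r.toNNReal)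
        = ∫ r in (0 : ℝ)..t, (p r + σ * b r.toNNReal) := by
      refine intervalIntegral.integral_congr fun r hr => ?_
      rw [Set.uIcc_of_le t.coe_nonneg] at hr
      simp only [Real.coe_toNNReal r hr.1]
    rw [hc, this, h0]
    ring
  · have := intervalIntegral.integral_eq_sub_of_hasDerivAt (a := 0) (b := t) (fun s _ => hp' s)
      (Continuous.intervalIntegrable (by fun_prop) _ _)
    have h0 : p 0 = z₀ := by simp [hp, hS]; field_simp
    have hc : ∫ r in (0 : ℝ)..t, -θ ^ 2 * Y r.toNNReal = ∫ r in (0 : ℝ)..t, -θ ^ 2 * Y r := by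
      refine intervalIntegral.integral_congr fun r hr => ?_
      rw [Set.uIcc_of_le t.coe_nonneg] at hr
      simp only [Real.coe_toNNReal r hr.1]
    rw [hc, this, h0]
    ring

end SWEK

namespace SWEK

/-! ### Wiener integrals of deterministic functions -/

open Filter Topology Finset

section Wiener

variable {Ω : Type*} [MeasurableSpace Ω] {P : Measure Ω}

/-- Independent Gaussian processes are jointly Gaussian. -/
lemma isGaussianProcess_uncurry_of_iIndepFun {ι T : Type*} [Fintype ι] {X : ι → T → Ω → ℝ}
    (hX : ∀ i, IsGaussianProcess (X i) P) (h : iIndepFun (fun i ω t => X i t ω) P) :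
    IsGaussianProcess (fun p : ι × T => X p.1 p.2) P where
  hasGaussianLaw I := by
    classical
    set J : Finset T := I.image Prod.snd with hJ
    have h1 : iIndepFun (fun i ω => J.restrict fun t => X i t ω) P :=
      h.comp (fun _ f => J.restrict f) fun _ => by fun_prop
    have h2 : HasGaussianLaw (fun ω i => J.restrict fun t => X i t ω) P :=
      iIndepFun.hasGaussianLaw (fun i => (hX i).hasGaussianLaw J) h1
    have hm : ∀ p : I, p.1.2 ∈ J := fun p => mem_image_of_mem _ p.2
    exact h2.map_fun (ContinuousLinearMap.pi fun p : I =>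
      (ContinuousLinearMap.proj (R := ℝ) (φ := fun _ : J => ℝ) ⟨p.1.2, hm p⟩).comp
        (ContinuousLinearMap.proj (R := ℝ) (φ := fun _ : ι => J → ℝ) p.1.1))

/-- Almost sure limits of centred Gaussian variables are Gaussian, with the limit variance. -/
lemma hasLaw_gaussianReal_of_tendsto [IsProbabilityMeasure P] {Z : ℕ → Ω → ℝ} {Y : Ω → ℝ}
    {v : ℕ → ℝ≥0} {w : ℝ≥0} (hZ : ∀ n, HasLaw (Z n) (gaussianReal 0 (v n)) P)
    (hv : Tendsto v atTop (𝓝 w)) (hlim : ∀ᵐ ω ∂P, Tendsto (fun n => Z n ω) atTop (𝓝 (Y ω))) :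
    HasLaw Y (gaussianReal 0 w) P := by
  have hY : AEMeasurable Y P :=
    aemeasurable_of_tendsto_metrizable_ae atTop (fun n => (hZ n).aemeasurable) hlim
  refine ⟨hY, ?_⟩
  have := Measure.isProbabilityMeasure_map (μ := P) hY
  refine Measure.ext_of_charFun (funext fun t => ?_)
  have hcf : ∀ X : Ω → ℝ, AEMeasurable X P →
      charFun (P.map X) t = ∫ ω, Complex.exp (t * X ω * Complex.I) ∂P := fun X hX => by
    rw [charFun_apply_real, integral_map hX (by fun_prop)]
  have h1 : Tendsto (fun n => charFun (P.map (Z n)) t) atTop (𝓝 (charFun (P.map Y) t)) := by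
    rw [hcf Y hY]
    simp_rw [hcf _ (hZ _).aemeasurable]
    refine tendsto_integral_of_dominated_convergence (fun _ => 1) (fun n => ?_)
      (integrable_const _) (fun n => .of_forall fun ω => ?_) ?_
    · have := (hZ n).aemeasurable
      exact (by fun_prop : AEMeasurable (fun ω => Complex.exp (t * Z n ω * Complex.I)) P)
        |>.aestronglyMeasurable
    · rw [← Complex.ofReal_mul, Complex.norm_exp_ofReal_mul_I]
    · filter_upwards [hlim] with ω hω
      have hc : Continuous fun x : ℝ => Complex.exp (t * x * Complex.I) := by fun_prop
      exact (hc.tendsto _).comp hω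
  have h2 : Tendsto (fun n => charFun (P.map (Z n)) t) atTop
      (𝓝 (charFun (gaussianReal 0 w) t)) := by
    simp_rw [(hZ _).map_eq, charFun_gaussianReal]
    have hc : Continuous fun x : ℝ≥0 =>
      Complex.exp (t * (0 : ℝ) * Complex.I - x * (t : ℂ) ^ 2 / 2) := by fun_prop
    exact (hc.tendsto w).comp hv
  exact tendsto_nhds_unique h1 h2

/-- Riemann sums on the uniform partition, with arbitrary sample points. -/
lemma tendsto_riemannSum {T : ℝ} (hT : 0 ≤ T) {b d : ℝ → ℝ} (hb : ContinuousOn b (Set.Icc 0 T))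
    (hd : IntervalIntegrable d volume 0 T) (ξ : ℕ → ℕ → ℝ)
    (hξ : ∀ n i : ℕ, ξ n i ∈ Set.Icc (T * i / (n + 1)) (T * (i + 1 : ℕ) / (n + 1))) :
    Tendsto (fun n : ℕ => ∑ i ∈ range (n + 1), b (ξ n i) *
        ∫ x in (T * i / (n + 1))..(T * (i + 1 : ℕ) / (n + 1)), d x)
      atTop (𝓝 (∫ x in (0 : ℝ)..T, b x * d x)) := by
  have hr0 : ∀ n i : ℕ, 0 ≤ T * i / (n + 1) := fun n i => by positivity
  have hrT : ∀ n i : ℕ, i ≤ n + 1 → T * i / (n + 1) ≤ T := fun n i hi => by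
    rw [div_le_iff₀ (by positivity)]
    exact mul_le_mul_of_nonneg_left (by exact_mod_cast hi) hT
  have hrm : ∀ n i : ℕ, T * i / (n + 1) ≤ T * (i + 1 : ℕ) / (n + 1) := fun n i => by
    gcongr; simp
  have hsub : ∀ n i : ℕ, i ∈ range (n + 1) →
      Set.uIcc (T * i / (n + 1)) (T * (i + 1 : ℕ) / (n + 1)) ⊆ Set.Icc 0 T := fun n i hi => by
    rw [Set.uIcc_of_le (hrm n i)]
    exact Set.Icc_subset_Icc (hr0 n i) (hrT n _ (by have := mem_range.1 hi; omega))
  have hsum : ∀ (n : ℕ) (f : ℝ → ℝ), IntervalIntegrable f volume 0 T →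
      ∑ i ∈ range (n + 1), ∫ x in (T * i / (n + 1))..(T * (i + 1 : ℕ) / (n + 1)), f x
        = ∫ x in (0 : ℝ)..T, f x := fun n f hf => by
    rw [intervalIntegral.sum_integral_adjacent_intervals (a := fun i : ℕ => T * i / (n + 1))]
    · have : T * (n + 1 : ℕ) / (n + 1) = T := by push_cast; field_simp
      simp only [this]
      simp
    · intro k hk
      exact hf.mono_set (by simpa [Set.uIcc_of_le hT] using hsub n k (mem_range.2 hk))
  have hbd : IntervalIntegrable (fun x => b x * d x) volume 0 T :=
    hd.continuousOn_mul (by rwa [Set.uIcc_of_le hT])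
  have huc := isCompact_Icc.uniformContinuousOn_of_continuous hb
  rw [Metric.uniformContinuousOn_iff] at huc
  set M := ∫ x in (0 : ℝ)..T, |d x| with hM
  have hM0 : 0 ≤ M := intervalIntegral.integral_nonneg hT fun _ _ => abs_nonneg _
  rw [Metric.tendsto_atTop]
  intro ε hε
  obtain ⟨δ, hδ, hbδ⟩ := huc (ε / (M + 1)) (by positivity)
  obtain ⟨N, hN⟩ := exists_nat_gt (T / δ)
  refine ⟨N, fun n hn => ?_⟩
  have hmesh : T / (n + 1) < δ := by
    rw [div_lt_iff₀ (by positivity)]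
    rw [div_lt_iff₀ hδ] at hN
    have : (N : ℝ) ≤ n := by exact_mod_cast hn
    nlinarith
  rw [Real.dist_eq, ← hsum n _ hbd, ← sum_sub_distrib]
  have hterm : ∀ i ∈ range (n + 1),
      |b (ξ n i) * (∫ x in (T * i / (n + 1))..(T * (i + 1 : ℕ) / (n + 1)), d x)
        - ∫ x in (T * i / (n + 1))..(T * (i + 1 : ℕ) / (n + 1)), b x * d x|
      ≤ ε / (M + 1) * ∫ x in (T * i / (n + 1))..(T * (i + 1 : ℕ) / (n + 1)), |d x| := by
    intro i hi
    have hs := hsub n i hi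
    have hs' : Set.uIcc (T * i / (n + 1)) (T * (i + 1 : ℕ) / (n + 1)) ⊆ Set.uIcc 0 T := by
      rwa [Set.uIcc_of_le hT]
    have hdi := hd.mono_set hs'
    rw [← intervalIntegral.integral_const_mul, ← intervalIntegral.integral_const_mul,
      ← intervalIntegral.integral_sub (hdi.const_mul _) (hbd.mono_set hs'), ← Real.norm_eq_abs]
    refine intervalIntegral.norm_integral_le_of_norm_le (hrm n i) (.of_forall fun x hx => ?_)
      (hdi.abs.const_mul _)
    rw [← sub_mul, Real.norm_eq_abs, abs_mul]
    refine mul_le_mul_of_nonneg_right ?_ (abs_nonneg _)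
    rw [← Real.dist_eq]
    rw [Set.uIcc_of_le (hrm n i)] at hs
    refine (hbδ _ (hs (hξ n i)) _ (hs ⟨hx.1.le, hx.2⟩) ?_).le
    have hlen : T * (i + 1 : ℕ) / (n + 1) - T * i / (n + 1) = T / (n + 1) := by
      push_cast; ring
    rw [Real.dist_eq, abs_lt]
    have := hξ n i
    constructor <;> linarith [this.1, this.2, hx.1, hx.2]
  calc _ ≤ ∑ i ∈ range (n + 1), ε / (M + 1) *
        ∫ x in (T * i / (n + 1))..(T * (i + 1 : ℕ) / (n + 1)), |d x| :=
        (abs_sum_le_sum_abs _ _).trans (sum_le_sum hterm)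
    _ = ε / (M + 1) * M := by rw [← mul_sum, hsum n _ hd.abs]
    _ < ε := by
      rw [div_mul_eq_mul_div, div_lt_iff₀ (by positivity)]
      nlinarith

variable {V : Type*} [Fintype V] {W : ℝ≥0 → Ω → EuclideanSpace ℝ V}

lemma IsBrownian.isGaussianProcess_coord (hW : IsBrownian W P) :
    IsGaussianProcess (fun (p : V × ℝ≥0) ω => W p.2 ω p.1) P :=
  isGaussianProcess_uncurry_of_iIndepFun (X := fun i t ω => W t ω i)
    (fun i => IsPreBrownianReal.isGaussianProcess (hW.coord i).toIsPreBrownianReal) hW.indep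

/-- The Wiener integral of a step function is centred Gaussian, with variance
the squared `L²` norm of the step function. -/
lemma IsBrownian.hasLaw_sum_increments [DecidableEq V] [IsProbabilityMeasure P]
    (hW : IsBrownian W P) {r : ℕ → ℝ≥0} (hr : Monotone r) (F : V → ℕ → ℝ) (n : ℕ) :
    HasLaw (fun ω => ∑ j, ∑ i ∈ range n, F j i * (W (r (i + 1)) ω j - W (r i) ω j))
      (gaussianReal 0 (∑ j, ∑ i ∈ range n, F j i ^ 2 * ((r (i + 1) : ℝ) - r i)).toNNReal) P := by
  set Y : V × ℕ → Ω → ℝ := fun p ω => W (r (p.2 + 1)) ω p.1 - W (r p.2) ω p.1 with hY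
  have hYG : IsGaussianProcess Y P := by
    refine hW.isGaussianProcess_coord.of_isGaussianProcess fun p => ?_
    exact ⟨{(p.1, r p.2), (p.1, r (p.2 + 1))},
      ContinuousLinearMap.proj (R := ℝ) (φ := fun _ => ℝ) ⟨(p.1, r (p.2 + 1)), by simp⟩ -
        ContinuousLinearMap.proj (R := ℝ) (φ := fun _ => ℝ) ⟨(p.1, r p.2), by simp⟩,
      fun ω => by simp [hY]⟩
  have hL2 : ∀ p, MemLp (Y p) 2 P := fun p => (hYG.hasGaussianLaw_eval p).memLp_two
  have hWL2 : ∀ j t, MemLp (fun ω => W t ω j) 2 P := fun j t =>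
    (hW.isGaussianProcess_coord.hasGaussianLaw_eval (j, t)).memLp_two
  -- Increments over distinct intervals, or of distinct coordinates, are uncorrelated.
  have hcov : ∀ p q, cov[Y p, Y q; P] = if p = q then ((r (p.2 + 1) : ℝ) - r p.2) else 0 := by
    rintro ⟨j, i⟩ ⟨k, l⟩
    by_cases hjk : j = k
    · subst hjk
      simp only [hY]
      rw [covariance_fun_sub_fun_sub (hWL2 _ _) (hWL2 _ _) (hWL2 _ _) (hWL2 _ _)]
      simp only [(hW.coord j).covariance_fun_eval]
      rcases lt_trichotomy i l with h | h | h
      · have h1 : r (i + 1) ≤ r l := hr h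
        have h2 := hr (Nat.le_succ i)
        have h3 := hr (Nat.le_succ l)
        rw [min_eq_left (h1.trans h3), min_eq_left h1, min_eq_left ((h2.trans h1).trans h3),
          min_eq_left (h2.trans h1), if_neg (by simp; omega)]
        ring
      · subst h
        have h2 := hr (Nat.le_succ i)
        rw [min_self, min_self, min_eq_left h2, min_eq_right h2, if_pos rfl]
        ring
      · have h1 : r (l + 1) ≤ r i := hr h
        have h2 := hr (Nat.le_succ l)
        have h3 := hr (Nat.le_succ i)
        rw [min_eq_right (h1.trans h3), min_eq_right h1, min_eq_right ((h2.trans h1).trans h3),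
          min_eq_right (h2.trans h1), if_neg (by simp; omega)]
        ring
    · rw [if_neg (by simp [hjk])]
      have hi : IndepFun (Y (j, i)) (Y (k, l)) P :=
        (hW.indep.indepFun hjk).comp (φ := fun f : ℝ≥0 → ℝ => f (r (i + 1)) - f (r i))
          (ψ := fun f : ℝ≥0 → ℝ => f (r (l + 1)) - f (r l)) (by fun_prop) (by fun_prop)
      exact hi.covariance_eq_zero (hL2 _) (hL2 _)
  set s : Finset (V × ℕ) := univ ×ˢ range n with hs
  have hsum : (fun ω => ∑ j, ∑ i ∈ range n, F j i * (W (r (i + 1)) ω j - W (r i) ω j))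
      = ∑ p ∈ s, fun ω => F p.1 p.2 * Y p ω := by
    funext ω
    rw [hs, Finset.sum_apply, sum_product]
  have hG : HasGaussianLaw (∑ p ∈ s, fun ω => F p.1 p.2 * Y p ω) P :=
    (hYG.smul fun p => F p.1 p.2).hasGaussianLaw_sum
  have hFL2 : ∀ p ∈ s, MemLp (fun ω => F p.1 p.2 * Y p ω) 2 P := fun p _ => (hL2 p).const_mul _
  have hvar : Var[∑ p ∈ s, fun ω => F p.1 p.2 * Y p ω; P]
      = ∑ j, ∑ i ∈ range n, F j i ^ 2 * ((r (i + 1) : ℝ) - r i) := by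
    rw [variance_sum' hFL2]
    simp only [covariance_const_mul_left, covariance_const_mul_right, hcov]
    rw [← sum_product (s := univ) (t := range n)
      (f := fun p : V × ℕ => F p.1 p.2 ^ 2 * ((r (p.2 + 1) : ℝ) - r p.2))]
    refine sum_congr rfl fun p hp => ?_
    rw [sum_eq_single_of_mem p hp fun q _ hq => by simp [hq.symm]]
    simp only [if_true]
    ring
  have hmean : ∫ ω, (∑ p ∈ s, fun ω => F p.1 p.2 * Y p ω) ω ∂P = 0 := by
    simp only [Finset.sum_apply]
    rw [integral_finsetSum _ fun p _ => ((hL2 p).integrable one_le_two).const_mul _]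
    refine sum_eq_zero fun p _ => ?_
    rw [integral_const_mul]
    simp only [hY]
    rw [integral_sub ((hWL2 _ _).integrable one_le_two) ((hWL2 _ _).integrable one_le_two),
      (hW.coord p.1).integral_eval, (hW.coord p.1).integral_eval]
    simp
  rw [hsum]
  refine ⟨hG.aemeasurable, ?_⟩
  rw [hG.map_eq_gaussianReal, hvar, hmean]

/-- `∑ j, ∫₀ᵀ d_j(x) W_j(x) dx` equals the Wiener integral `∑ j, ∫₀ᵀ D_j dW_j` of the primitive
`D_j(x) = ∫ₓᵀ d_j`, so it is centred Gaussian and the Itô isometry gives its variance. -/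
lemma IsBrownian.hasLaw_integral [DecidableEq V] [IsProbabilityMeasure P] (hW : IsBrownian W P)
    (T : ℝ≥0) {d : V → ℝ → ℝ} (hd : ∀ j, IntervalIntegrable (d j) volume 0 T) :
    HasLaw (fun ω => ∑ j, ∫ x in (0 : ℝ)..T, W x.toNNReal ω j * d j x)
      (gaussianReal 0
        (∑ j, ∫ x in (0 : ℝ)..T, (∫ r in x..(T : ℝ), d j r) ^ 2).toNNReal) P := by
  set r : ℕ → ℕ → ℝ≥0 := fun n i => T * i / (n + 1) with hr
  have hrc : ∀ n i, (r n i : ℝ) = T * i / (n + 1) := fun n i => by simp [hr]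
  have hrm : ∀ n, Monotone (r n) := fun n i k h => by simp only [hr]; gcongr
  have hrT : ∀ n, r n (n + 1) = T := fun n => by simp only [hr]; push_cast; field_simp
  have hr0 : ∀ n, r n 0 = 0 := fun n => by simp [hr]
  have hξl : ∀ n i : ℕ, (r n i : ℝ) ∈
      Set.Icc ((T : ℝ) * i / (n + 1)) (T * (i + 1 : ℕ) / (n + 1)) := fun n i => by
    rw [← hrc, ← hrc]; exact ⟨le_rfl, hrm n (Nat.le_succ i)⟩
  have hξr : ∀ n i : ℕ, (r n (i + 1) : ℝ) ∈
      Set.Icc ((T : ℝ) * i / (n + 1)) (T * (i + 1 : ℕ) / (n + 1)) := fun n i => by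
    rw [← hrc, ← hrc]; exact ⟨hrm n (Nat.le_succ i), le_rfl⟩
  set D : V → ℝ → ℝ := fun j x => ∫ r in x..(T : ℝ), d j r with hD
  have hDc : ∀ j, ContinuousOn (D j) (Set.Icc 0 T) := fun j => by
    have h := intervalIntegral.continuousOn_primitive_interval_left
      (μ := volume) (f := d j) (a := 0) (b := T)
      (by rw [Set.uIcc_of_le T.coe_nonneg, integrableOn_Icc_iff_integrableOn_Ioc]
          exact (intervalIntegrable_iff_integrableOn_Ioc_of_le T.coe_nonneg).1 (hd j))
    rwa [Set.uIcc_of_le T.coe_nonneg] at h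
  refine hasLaw_gaussianReal_of_tendsto
    (fun n => hW.hasLaw_sum_increments (hrm n) (fun j i => D j (r n i)) (n + 1)) ?_ ?_
  · refine (continuous_real_toNNReal.tendsto _).comp (tendsto_finsetSum _ fun j _ => ?_)
    have := tendsto_riemannSum T.coe_nonneg ((hDc j).pow 2) (d := fun _ => 1)
      intervalIntegrable_const (fun n i => r n i) hξl
    simpa [hrc] using this
  · have hcont : ∀ᵐ ω ∂P, ∀ j, Continuous fun t => W t ω j :=
      ae_all_iff.2 fun j => (hW.coord j).cont
    have hzero : ∀ᵐ ω ∂P, ∀ j, W 0 ω j = 0 :=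
      ae_all_iff.2 fun j => (hW.coord j).eval_zero_ae_eq_zero
    filter_upwards [hcont, hzero] with ω hc h0
    refine tendsto_finsetSum _ fun j _ => ?_
    have hcj := hc j
    have := tendsto_riemannSum T.coe_nonneg (b := fun x => W x.toNNReal ω j)
      (hcj.comp continuous_real_toNNReal).continuousOn (hd j) (fun n i => r n (i + 1)) hξr
    refine this.congr fun n => ?_
    -- Abel summation: the boundary terms telescope and vanish, since `D_j(T) = 0` and `W_0 = 0`.
    have hsplit : ∀ i ∈ range (n + 1),
        W (r n (i + 1) : ℝ).toNNReal ω j *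
          (∫ x in ((T : ℝ) * i / (n + 1))..(T * (i + 1 : ℕ) / (n + 1)), d j x)
        = D j (r n i) * (W (r n (i + 1)) ω j - W (r n i) ω j)
          - (W (r n (i + 1)) ω j * D j (r n (i + 1)) - W (r n i) ω j * D j (r n i)) := by
      intro i hi
      have hle : r n (i + 1) ≤ T := by
        have : i + 1 ≤ n + 1 := by have := mem_range.1 hi; omega
        calc r n (i + 1) ≤ r n (n + 1) := hrm n this
          _ = T := hrT n
      have hle' : r n i ≤ T := (hrm n (Nat.le_succ i)).trans hle
      have hsub : ∀ a b : ℝ≥0, a ≤ T → b ≤ T → IntervalIntegrable (d j) volume (a : ℝ) b :=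
        fun a b ha hb => (hd j).mono_set (Set.uIcc_subset_uIcc
          (by rw [Set.uIcc_of_le T.coe_nonneg]; exact ⟨a.coe_nonneg, ha⟩)
          (by rw [Set.uIcc_of_le T.coe_nonneg]; exact ⟨b.coe_nonneg, hb⟩))
      have hint : (∫ x in ((T : ℝ) * i / (n + 1))..(T * (i + 1 : ℕ) / (n + 1)), d j x)
          = D j (r n i) - D j (r n (i + 1)) := by
        rw [← hrc, ← hrc]
        simp only [hD]
        rw [eq_sub_iff_add_eq, intervalIntegral.integral_add_adjacent_intervals
          (hsub _ _ hle' hle) (hsub _ _ hle le_rfl)]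
      rw [hint, Real.toNNReal_coe]
      ring
    rw [sum_congr rfl hsplit, sum_sub_distrib,
      sum_range_sub (fun i => W (r n i) ω j * D j (r n i)), hrT, hr0, h0 j]
    simp [hD]

end Wiener

end SWEK

namespace SWEK

/-! ### Solutions along a single path -/

section Pathwise

open Matrix

variable {V : Type*} [Fintype V] [DecidableEq V]

/-- The coordinate `y_k = (U x)_k` of `x` in the eigenbasis. -/
noncomputable def eigenCoord (U : Matrix V V ℝ) (k : V) : EuclideanSpace ℝ V →L[ℝ] ℝ :=
  (EuclideanSpace.proj k).comp (toEuclideanCLM (𝕜 := ℝ) U)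

lemma toEuclideanCLM_apply_apply (M : Matrix V V ℝ) (x : EuclideanSpace ℝ V) (i : V) :
    toEuclideanCLM (𝕜 := ℝ) M x i = ∑ j, M i j * x j := by
  rw [ofLp_toEuclideanCLM]; rfl

lemma eigenCoord_apply (U : Matrix V V ℝ) (k : V) (x : EuclideanSpace ℝ V) :
    eigenCoord U k x = ∑ j, U k j * x j :=
  toEuclideanCLM_apply_apply U x k

variable {U : Matrix V V ℝ}

lemma isUnit_of_orthogonal (hU : Uᵀ * U = 1) : IsUnit U :=
  IsUnit.of_mul_eq_one _ (mul_eq_one_comm.1 hU)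

lemma conjDiag_eq_transpose (hU : Uᵀ * U = 1) (f : V → ℝ) :
    conjDiag U f = Uᵀ * diagonal f * U := by
  rw [conjDiag, inv_eq_left_inv hU]

lemma conjDiag_apply (hU : Uᵀ * U = 1) (f : V → ℝ) (i j : V) :
    conjDiag U f i j = ∑ k, U k i * f k * U k j := by
  simp only [conjDiag_eq_transpose hU, mul_apply (M := Uᵀ * diagonal f), mul_diagonal,
    transpose_apply]

lemma conjDiag_symm (hU : Uᵀ * U = 1) (f : V → ℝ) (i j : V) :
    conjDiag U f i j = conjDiag U f j i := by
  simp only [conjDiag_apply hU]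
  exact Finset.sum_congr rfl fun k _ => by ring

lemma apply_eq_sum_eigenCoord (hU : Uᵀ * U = 1) (x : EuclideanSpace ℝ V) (i : V) :
    x i = ∑ k, U k i * eigenCoord U k x := by
  have h : toEuclideanCLM (𝕜 := ℝ) Uᵀ (toEuclideanCLM (𝕜 := ℝ) U x) = x := by
    rw [← mul_apply_eq_comp, ← map_mul, hU, map_one]; rfl
  conv_lhs => rw [← h]
  rw [toEuclideanCLM_apply_apply]
  rfl

lemma ext_eigenCoord (hU : Uᵀ * U = 1) {x y : EuclideanSpace ℝ V}
    (h : ∀ k, eigenCoord U k x = eigenCoord U k y) : x = y := by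
  ext i
  rw [apply_eq_sum_eigenCoord hU x, apply_eq_sum_eigenCoord hU y]
  simp only [h]

lemma toEuclideanCLM_conjDiag_apply (hU : Uᵀ * U = 1) (f : V → ℝ) (x : EuclideanSpace ℝ V)
    (i : V) : toEuclideanCLM (𝕜 := ℝ) (conjDiag U f) x i
      = ∑ k, U k i * (f k * eigenCoord U k x) := by
  simp only [toEuclideanCLM_apply_apply, conjDiag_apply hU, eigenCoord_apply, Finset.sum_mul,
    Finset.mul_sum]
  rw [Finset.sum_comm]
  exact Finset.sum_congr rfl fun k _ => Finset.sum_congr rfl fun j _ => by ring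

lemma eigenCoord_conjDiag (hU' : U * Uᵀ = 1) (f : V → ℝ) (x : EuclideanSpace ℝ V) (k : V) :
    eigenCoord U k (toEuclideanCLM (𝕜 := ℝ) (conjDiag U f) x) = f k * eigenCoord U k x := by
  have h : U * conjDiag U f = diagonal f * U := by
    rw [conjDiag_eq_transpose (mul_eq_one_comm.1 hU'), Matrix.mul_assoc, ← Matrix.mul_assoc, hU',
      Matrix.one_mul]
  have : toEuclideanCLM (𝕜 := ℝ) U (toEuclideanCLM (𝕜 := ℝ) (conjDiag U f) x)
      = toEuclideanCLM (𝕜 := ℝ) (diagonal f) (toEuclideanCLM (𝕜 := ℝ) U x) := by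
    rw [← mul_apply_eq_comp, ← map_mul, h, map_mul]; rfl
  change toEuclideanCLM (𝕜 := ℝ) U (toEuclideanCLM (𝕜 := ℝ) (conjDiag U f) x) k = _
  rw [this, toEuclideanCLM_apply_apply]
  simp only [diagonal_apply, ite_mul, zero_mul, Finset.sum_ite_eq, Finset.mem_univ, if_true]
  rfl

/-- The equation along one path, in the form in which it decouples into scalar oscillators. -/
lemma isPathSolution_iff (hU : Uᵀ * U = 1) (hU' : U * Uᵀ = 1) {lam : V → ℝ} {c : ℝ} (σ : ℝ)
    {θ : V → ℝ} (hθ : ∀ k, θ k ^ 2 = c ^ 2 * lam k) (u₀ v₀ : EuclideanSpace ℝ V)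
    {w u v : ℝ≥0 → EuclideanSpace ℝ V} (hu : Continuous u) (hv : Continuous v) (t : ℝ≥0) :
    (u t = u₀ + ∫ r in (0 : ℝ)..t, v r.toNNReal ∧
      v t = v₀ + (∫ r in (0 : ℝ)..t, -(c ^ 2) •
        toEuclideanCLM (𝕜 := ℝ) (conjDiag U lam) (u r.toNNReal)) + σ • w t) ↔
    ∀ k, eigenCoord U k (u t) = eigenCoord U k u₀ +
        (∫ r in (0 : ℝ)..t, eigenCoord U k (v r.toNNReal)) ∧
      eigenCoord U k (v t) = eigenCoord U k v₀ +
        (∫ r in (0 : ℝ)..t, -θ k ^ 2 * eigenCoord U k (u r.toNNReal)) +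
        σ * eigenCoord U k (w t) := by
  have h1 : ∀ k, eigenCoord U k (u₀ + ∫ r in (0 : ℝ)..t, v r.toNNReal)
      = eigenCoord U k u₀ + ∫ r in (0 : ℝ)..t, eigenCoord U k (v r.toNNReal) := fun k => by
    rw [map_add, ContinuousLinearMap.intervalIntegral_comp_comm _
      (Continuous.intervalIntegrable (by fun_prop) _ _)]
  have h2 : ∀ k, eigenCoord U k (v₀ + (∫ r in (0 : ℝ)..t, -(c ^ 2) •
        toEuclideanCLM (𝕜 := ℝ) (conjDiag U lam) (u r.toNNReal)) + σ • w t)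
      = eigenCoord U k v₀ + (∫ r in (0 : ℝ)..t, -θ k ^ 2 * eigenCoord U k (u r.toNNReal)) +
        σ * eigenCoord U k (w t) := fun k => by
    rw [map_add, map_add, ← ContinuousLinearMap.intervalIntegral_comp_comm _
      (Continuous.intervalIntegrable (by fun_prop) _ _), map_smul, smul_eq_mul]
    congr 3
    funext r
    rw [map_smul, eigenCoord_conjDiag hU', smul_eq_mul, hθ]
    ring
  constructor
  · rintro ⟨hu1, hv1⟩ k
    rw [← h1, ← h2]
    exact ⟨congrArg _ hu1, congrArg _ hv1⟩
  · intro h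
    exact ⟨ext_eigenCoord hU fun k => by rw [h1]; exact (h k).1,
      ext_eigenCoord hU fun k => by rw [h2]; exact (h k).2⟩

/-- A path solution is the mean plus `σ ∫₀ᵗ cos(Θ (t - r)) w(r) dr`. In particular it is determined
by the driving path `w`. -/
lemma pathSolution_eq (hU : Uᵀ * U = 1) (hU' : U * Uᵀ = 1) {lam : V → ℝ} (hlam : ∀ k, 0 < lam k)
    {c : ℝ} (hc : c ≠ 0) (σ : ℝ) {A : Matrix V V ℝ} (hA : IsSelfAdjoint A) (h : A = conjDiag U lam)
    (u₀ v₀ : EuclideanSpace ℝ V) {w u v : ℝ≥0 → EuclideanSpace ℝ V} (hw : Continuous w)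
    (hu : Continuous u) (hv : Continuous v)
    (heq : ∀ t : ℝ≥0, u t = u₀ + ∫ r in (0 : ℝ)..t, v r.toNNReal ∧
      v t = v₀ + (∫ r in (0 : ℝ)..t, -(c ^ 2) •
        toEuclideanCLM (𝕜 := ℝ) A (u r.toNNReal)) + σ • w t) (t : ℝ≥0) (i : V) :
    u t i = mean c A u₀ v₀ t i + σ * ∑ j, ∫ r in (0 : ℝ)..t, w r.toNNReal j *
      conjDiag U (fun k => Real.cos ((t - r) * (c * √(lam k)))) i j := by
  have hθ : ∀ k, (c * √(lam k)) ^ 2 = c ^ 2 * lam k := fun k => by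
    rw [mul_pow, Real.sq_sqrt (hlam k).le]
  have hθ0 : ∀ k, c * √(lam k) ≠ 0 := fun k => mul_ne_zero hc (Real.sqrt_pos.2 (hlam k)).ne'
  have heq' := fun t => (isPathSolution_iff hU hU' σ hθ u₀ v₀ hu hv t).1 (h ▸ heq t)
  have hosc := fun k => oscillator_eq (hθ0 k) (y := fun t => eigenCoord U k (u t))
    (z := fun t => eigenCoord U k (v t)) (b := fun t => eigenCoord U k (w t))
    (by fun_prop) (by fun_prop) (by fun_prop) (fun t => (heq' t k).1) (fun t => (heq' t k).2) t
  have hpow : ∀ k, 1 / c * (lam k ^ (-(1 / 2) : ℝ) * Real.sin (t * (c * √(lam k))))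
      = Real.sin (t * (c * √(lam k))) / (c * √(lam k)) := fun k => by
    rw [Real.rpow_neg (hlam k).le, ← Real.sqrt_eq_rpow]
    field_simp
  have hnoise : ∑ j, ∫ r in (0 : ℝ)..t, w r.toNNReal j *
        conjDiag U (fun k => Real.cos ((t - r) * (c * √(lam k)))) i j
      = ∑ k, U k i * ∫ r in (0 : ℝ)..t, eigenCoord U k (w r.toNNReal) *
        Real.cos ((t - r) * (c * √(lam k))) := by
    simp only [conjDiag_apply hU]
    rw [← intervalIntegral.integral_finsetSum fun j _ =>
      Continuous.intervalIntegrable (by fun_prop) _ _]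
    simp only [← intervalIntegral.integral_const_mul]
    rw [← intervalIntegral.integral_finsetSum fun j _ =>
      Continuous.intervalIntegrable (by fun_prop) _ _]
    refine intervalIntegral.integral_congr fun r _ => ?_
    simp only [eigenCoord_apply, Finset.mul_sum, Finset.sum_mul]
    rw [Finset.sum_comm]
    exact Finset.sum_congr rfl fun k _ => Finset.sum_congr rfl fun j _ => by ring
  rw [mean_eq_conjDiag (isUnit_of_orthogonal hU) hA h, PiLp.add_apply,
    toEuclideanCLM_conjDiag_apply hU, toEuclideanCLM_conjDiag_apply hU, hnoise,
    apply_eq_sum_eigenCoord hU (u t) i, Finset.mul_sum, ← Finset.sum_add_distrib,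
    ← Finset.sum_add_distrib]
  refine Finset.sum_congr rfl fun k _ => ?_
  rw [hosc k, hpow]
  ring

lemma exists_pathSolution (hU : Uᵀ * U = 1) (hU' : U * Uᵀ = 1) {lam : V → ℝ}
    (hlam : ∀ k, 0 < lam k) {c : ℝ} (hc : c ≠ 0) (σ : ℝ) (u₀ v₀ : EuclideanSpace ℝ V)
    {w : ℝ≥0 → EuclideanSpace ℝ V} (hw : Continuous w) :
    ∃ u v : ℝ≥0 → EuclideanSpace ℝ V, Continuous u ∧ Continuous v ∧
      ∀ t : ℝ≥0, u t = u₀ + ∫ r in (0 : ℝ)..t, v r.toNNReal ∧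
        v t = v₀ + (∫ r in (0 : ℝ)..t, -(c ^ 2) •
          toEuclideanCLM (𝕜 := ℝ) (conjDiag U lam) (u r.toNNReal)) + σ • w t := by
  have hθ : ∀ k, (c * √(lam k)) ^ 2 = c ^ 2 * lam k := fun k => by
    rw [mul_pow, Real.sq_sqrt (hlam k).le]
  have hθ0 : ∀ k, c * √(lam k) ≠ 0 := fun k => mul_ne_zero hc (Real.sqrt_pos.2 (hlam k)).ne'
  choose y z hy hz h1 h2 using fun k => exists_oscillator (hθ0 k) σ (eigenCoord U k u₀)
    (eigenCoord U k v₀) (b := fun t => eigenCoord U k (w t)) (by fun_prop)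
  set lift : (V → ℝ) → EuclideanSpace ℝ V :=
    fun x => toEuclideanCLM (𝕜 := ℝ) Uᵀ (WithLp.toLp 2 x) with hlift
  have hcoord : ∀ x k, eigenCoord U k (lift x) = x k := fun x k => by
    have : toEuclideanCLM (𝕜 := ℝ) U (lift x) = WithLp.toLp 2 x := by
      rw [hlift, ← mul_apply_eq_comp, ← map_mul, hU', map_one]; rfl
    change toEuclideanCLM (𝕜 := ℝ) U (lift x) k = _
    rw [this]
  have hliftc : Continuous lift := by
    simp only [hlift]; fun_prop
  have hyc : Continuous fun t => lift fun k => y k t := by fun_prop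
  have hzc : Continuous fun t => lift fun k => z k t := by fun_prop
  refine ⟨fun t => lift fun k => y k t, fun t => lift fun k => z k t, hyc, hzc, fun t => ?_⟩
  refine (isPathSolution_iff hU hU' σ hθ u₀ v₀ hyc hzc t).2 fun k => ?_
  simp only [hcoord]
  exact ⟨h1 k t, h2 k t⟩

end Pathwise

end SWEK

namespace SWEK

/-! ### Processes that are integrals of Brownian paths -/

section GaussianSolution

open Finset

variable {Ω : Type*} [MeasurableSpace Ω] {P : Measure Ω} {V : Type*} [Fintype V]
  {W : ℝ≥0 → Ω → EuclideanSpace ℝ V}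

lemma intervalIntegrable_fun_sum {ι : Type*} {s : Finset ι} {f : ι → ℝ → ℝ} {a b : ℝ}
    (h : ∀ i ∈ s, IntervalIntegrable (f i) volume a b) :
    IntervalIntegrable (fun x => ∑ i ∈ s, f i x) volume a b := by
  simpa only [Finset.sum_fn] using IntervalIntegrable.sum s h

lemma covariance_congr_ae {μ : Measure Ω} {X X' Y Y' : Ω → ℝ} (hX : X =ᵐ[μ] X')
    (hY : Y =ᵐ[μ] Y') : cov[X, Y; μ] = cov[X', Y'; μ] := by
  rw [covariance, covariance, integral_congr_ae hX, integral_congr_ae hY]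
  refine integral_congr_ae ?_
  filter_upwards [hX, hY] with ω h1 h2
  rw [h1, h2]

lemma IsBrownian.ae_continuous (hW : IsBrownian W P) : ∀ᵐ ω ∂P, Continuous fun t => W t ω := by
  filter_upwards [ae_all_iff.2 fun j => (hW.coord j).cont] with ω hω
  exact (PiLp.continuous_toLp 2 _).comp (continuous_pi hω)

variable [DecidableEq V] [IsProbabilityMeasure P]

lemma IsBrownian.memLp_integral (hW : IsBrownian W P) (T : ℝ≥0) {d : V → ℝ → ℝ}
    (hd : ∀ j, IntervalIntegrable (d j) volume 0 T) :
    MemLp (fun ω => ∑ j, ∫ x in (0 : ℝ)..T, W x.toNNReal ω j * d j x) 2 P :=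
  (hW.hasLaw_integral T hd).hasGaussianLaw.memLp_two

lemma IsBrownian.variance_integral (hW : IsBrownian W P) (T : ℝ≥0) {d : V → ℝ → ℝ}
    (hd : ∀ j, IntervalIntegrable (d j) volume 0 T) :
    Var[fun ω => ∑ j, ∫ x in (0 : ℝ)..T, W x.toNNReal ω j * d j x; P] =
      ∑ j, ∫ x in (0 : ℝ)..T, (∫ r in x..(T : ℝ), d j r) ^ 2 := by
  rw [(hW.hasLaw_integral T hd).variance_eq, variance_id_gaussianReal, Real.coe_toNNReal]
  exact sum_nonneg fun j _ =>
    intervalIntegral.integral_nonneg T.coe_nonneg fun _ _ => sq_nonneg _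

lemma continuousOn_integral_left {T : ℝ≥0} {d : ℝ → ℝ} (hd : IntervalIntegrable d volume 0 T) :
    ContinuousOn (fun x => ∫ r in x..(T : ℝ), d r) (Set.uIcc 0 T) :=
  intervalIntegral.continuousOn_primitive_interval_left
    (by rw [Set.uIcc_of_le T.coe_nonneg, integrableOn_Icc_iff_integrableOn_Ioc]
        exact (intervalIntegrable_iff_integrableOn_Ioc_of_le T.coe_nonneg).1 hd)

/-- Polarized Itô isometry. -/
lemma IsBrownian.covariance_integral (hW : IsBrownian W P) (T : ℝ≥0) {d e : V → ℝ → ℝ}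
    (hd : ∀ j, IntervalIntegrable (d j) volume 0 T)
    (he : ∀ j, IntervalIntegrable (e j) volume 0 T) :
    cov[fun ω => ∑ j, ∫ x in (0 : ℝ)..T, W x.toNNReal ω j * d j x,
        fun ω => ∑ j, ∫ x in (0 : ℝ)..T, W x.toNNReal ω j * e j x; P] =
      ∑ j, ∫ x in (0 : ℝ)..T, (∫ r in x..(T : ℝ), d j r) * ∫ r in x..(T : ℝ), e j r := by
  have hadd : (fun ω => ∑ j, ∫ x in (0 : ℝ)..T, W x.toNNReal ω j * (d j x + e j x)) =ᵐ[P]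
      (fun ω => ∑ j, ∫ x in (0 : ℝ)..T, W x.toNNReal ω j * d j x) +
        fun ω => ∑ j, ∫ x in (0 : ℝ)..T, W x.toNNReal ω j * e j x := by
    filter_upwards [hW.ae_continuous] with ω hω
    rw [Pi.add_apply, ← sum_add_distrib]
    refine sum_congr rfl fun j _ => ?_
    have hc : ContinuousOn (fun x : ℝ => W x.toNNReal ω j) (Set.uIcc 0 T) :=
      Continuous.continuousOn (by fun_prop)
    rw [← intervalIntegral.integral_add ((hd j).continuousOn_mul hc)
      ((he j).continuousOn_mul hc)]
    simp only [mul_add]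
  -- Expand the variance of the integral of `d + e` in two ways.
  have h1 := hW.variance_integral T fun j => (hd j).add (he j)
  rw [variance_congr hadd, variance_add (hW.memLp_integral T hd) (hW.memLp_integral T he),
    hW.variance_integral T hd, hW.variance_integral T he] at h1
  have h2 : ∑ j, ∫ x in (0 : ℝ)..T, (∫ r in x..(T : ℝ), (d j r + e j r)) ^ 2
      = (∑ j, ∫ x in (0 : ℝ)..T, (∫ r in x..(T : ℝ), d j r) ^ 2) +
        2 * (∑ j, ∫ x in (0 : ℝ)..T, (∫ r in x..(T : ℝ), d j r) * ∫ r in x..(T : ℝ), e j r) +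
        ∑ j, ∫ x in (0 : ℝ)..T, (∫ r in x..(T : ℝ), e j r) ^ 2 := by
    rw [mul_sum, ← sum_add_distrib, ← sum_add_distrib]
    refine sum_congr rfl fun j _ => ?_
    have hcd := continuousOn_integral_left (hd j)
    have hce := continuousOn_integral_left (he j)
    have hi1 : IntervalIntegrable (fun x => (∫ r in x..(T : ℝ), d j r) ^ 2) volume 0 T :=
      (hcd.pow 2).intervalIntegrable
    have hi2 : IntervalIntegrable (fun x => 2 *
        ((∫ r in x..(T : ℝ), d j r) * ∫ r in x..(T : ℝ), e j r)) volume 0 T :=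
      ((hcd.mul hce).intervalIntegrable).const_mul 2
    have hi3 : IntervalIntegrable (fun x => (∫ r in x..(T : ℝ), e j r) ^ 2) volume 0 T :=
      (hce.pow 2).intervalIntegrable
    rw [← intervalIntegral.integral_const_mul, ← intervalIntegral.integral_add hi1 hi2,
      ← intervalIntegral.integral_add (hi1.add hi2) hi3]
    refine intervalIntegral.integral_congr fun x hx => ?_
    have hsub : Set.uIcc x (T : ℝ) ⊆ Set.uIcc 0 T := Set.uIcc_subset_uIcc hx Set.right_mem_uIcc
    rw [intervalIntegral.integral_add ((hd j).mono_set hsub) ((he j).mono_set hsub)]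
    ring
  linarith

variable {X : ℝ≥0 → Ω → EuclideanSpace ℝ V} {m : ℝ≥0 → EuclideanSpace ℝ V}
  {g : ℝ≥0 → V → V → ℝ → ℝ}

/-- A process of the form `X_t = m_t + ∑ j, ∫₀ᵀ g_{t,·,j}(r) W_j(r) dr` is Gaussian: every linear
functional of finitely many of its values is a constant plus an integral of the same kind. -/
lemma IsBrownian.isGaussianProcess_of_eq_integral (hW : IsBrownian W P)
    (hg : ∀ t i j (T : ℝ≥0), IntervalIntegrable (g t i j) volume 0 T)
    (hX : ∀ T : ℝ≥0, ∀ᵐ ω ∂P, ∀ t ≤ T, ∀ i, X t ω i =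
      m t i + ∑ j, ∫ x in (0 : ℝ)..T, W x.toNNReal ω j * g t i j x) :
    IsGaussianProcess X P where
  hasGaussianLaw I := by
    set T : ℝ≥0 := I.sup id with hT
    have hIT : ∀ t ∈ I, t ≤ T := fun t ht => le_sup (f := id) ht
    have hmeas : ∀ t, AEMeasurable (X t) P := fun t => by
      have h : AEMeasurable (fun ω => fun i => X t ω i) P := by
        refine aemeasurable_pi_lambda _ fun i => ?_
        refine AEMeasurable.congr (f := fun ω => m t i +
          ∑ j, ∫ x in (0 : ℝ)..t, W x.toNNReal ω j * g t i j x) ?_ ?_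
        · exact (hW.hasLaw_integral t fun j => hg t i j t).aemeasurable.const_add _
        · filter_upwards [hX t] with ω hω
          exact (hω t le_rfl i).symm
      exact (WithLp.measurable_toLp 2 _).comp_aemeasurable h
    have hmeasI : AEMeasurable (fun ω => I.restrict fun t => X t ω) P :=
      aemeasurable_pi_lambda _ fun t => hmeas t
    refine ⟨isGaussian_of_isGaussian_map fun L => ?_⟩
    rw [AEMeasurable.map_map_of_aemeasurable (by fun_prop) hmeasI]
    -- The coefficients of `L` in the coordinates `(t, i)`.
    set a : I → V → ℝ := fun t i => L (Pi.single t (EuclideanSpace.single i 1)) with ha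
    have hL : ∀ f : I → EuclideanSpace ℝ V, L f = ∑ t, ∑ i, f t i * a t i := fun f => by
      have : f = ∑ t, ∑ i, f t i • Pi.single t (EuclideanSpace.single i (1 : ℝ)) := by
        funext t
        ext i
        simp [Finset.sum_apply, Pi.single_apply, apply_ite]
      conv_lhs => rw [this]
      simp [ha]
    have hd : ∀ j, IntervalIntegrable (fun x => ∑ t : I, ∑ i, a t i * g t i j x) volume 0 T :=
      fun j => intervalIntegrable_fun_sum fun t _ => intervalIntegrable_fun_sum fun i _ =>
        (hg t i j T).const_mul _
    have hlaw := hW.hasLaw_integral T hd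
    have hlaw' := gaussianReal_const_add hlaw (∑ t : I, ∑ i, m t i * a t i)
    have heq : (L ∘ fun ω => I.restrict fun t => X t ω) =ᵐ[P] fun ω =>
        (∑ t : I, ∑ i, m t i * a t i) + ∑ j, ∫ x in (0 : ℝ)..T, W x.toNNReal ω j *
          ∑ t : I, ∑ i, a t i * g t i j x := by
      filter_upwards [hX T, hW.ae_continuous] with ω hω hc
      rw [Function.comp_apply, hL]
      have hi : ∀ (t : I) i j, IntervalIntegrable (fun x : ℝ => W x.toNNReal ω j * g t i j x)
          volume 0 T := fun t i j =>
        (hg t i j T).continuousOn_mul (Continuous.continuousOn (by fun_prop))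
      have hj : ∀ j, (∫ x in (0 : ℝ)..T, W x.toNNReal ω j * ∑ t : I, ∑ i, a t i * g t i j x)
          = ∑ t : I, ∑ i, (∫ x in (0 : ℝ)..T, W x.toNNReal ω j * g t i j x) * a t i := fun j => by
        simp only [← intervalIntegral.integral_mul_const]
        have h1 : ∀ t : I, ∑ i, (∫ x in (0 : ℝ)..T, W x.toNNReal ω j * g t i j x * a t i) =
            ∫ x in (0 : ℝ)..T, ∑ i, W x.toNNReal ω j * g t i j x * a t i := fun t =>
          (intervalIntegral.integral_finsetSum fun i _ => (hi t i j).mul_const _).symm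
        simp_rw [h1]
        rw [← intervalIntegral.integral_finsetSum fun t _ =>
          intervalIntegrable_fun_sum fun i _ => (hi t i j).mul_const _]
        refine intervalIntegral.integral_congr fun x _ => ?_
        simp only [mul_sum]
        exact sum_congr rfl fun t _ => sum_congr rfl fun i _ => by ring
      simp_rw [hj]
      rw [sum_comm (s := (univ : Finset V)) (t := (univ : Finset I)), ← sum_add_distrib]
      refine sum_congr rfl fun t _ => ?_
      rw [sum_comm (s := (univ : Finset V)) (t := (univ : Finset V)), ← sum_add_distrib]
      refine sum_congr rfl fun i _ => ?_
      rw [Finset.restrict, hω t (hIT t t.2) i, add_mul, sum_mul]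
    rw [Measure.map_congr heq, hlaw'.map_eq]
    infer_instance

lemma IsBrownian.integral_of_eq_integral (hW : IsBrownian W P)
    (hg : ∀ t i j (T : ℝ≥0), IntervalIntegrable (g t i j) volume 0 T)
    (hX : ∀ T : ℝ≥0, ∀ᵐ ω ∂P, ∀ t ≤ T, ∀ i, X t ω i =
      m t i + ∑ j, ∫ x in (0 : ℝ)..T, W x.toNNReal ω j * g t i j x) (t : ℝ≥0) :
    ∫ ω, X t ω ∂P = m t := by
  have hint : Integrable (X t) P :=
    ((hW.isGaussianProcess_of_eq_integral hg hX).hasGaussianLaw_eval t).integrable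
  ext i
  have h1 : (∫ ω, X t ω ∂P) i = ∫ ω, X t ω i ∂P :=
    ((EuclideanSpace.proj (𝕜 := ℝ) i).integral_comp_comm hint).symm
  have h2 : ∫ ω, X t ω i ∂P =
      ∫ ω, (m t i + ∑ j, ∫ x in (0 : ℝ)..t, W x.toNNReal ω j * g t i j x) ∂P := by
    refine integral_congr_ae ?_
    filter_upwards [hX t] with ω hω
    exact hω t le_rfl i
  have hd : ∀ j, IntervalIntegrable (g t i j) volume 0 t := fun j => hg t i j t
  rw [h1, h2, integral_add (integrable_const _) ((hW.memLp_integral t hd).integrable one_le_two),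
    (hW.hasLaw_integral t hd).integral_eq, integral_id_gaussianReal]
  simp

lemma IsBrownian.covariance_of_eq_integral (hW : IsBrownian W P)
    (hg : ∀ t i j (T : ℝ≥0), IntervalIntegrable (g t i j) volume 0 T)
    (hX : ∀ T : ℝ≥0, ∀ᵐ ω ∂P, ∀ t ≤ T, ∀ i, X t ω i =
      m t i + ∑ j, ∫ x in (0 : ℝ)..T, W x.toNNReal ω j * g t i j x)
    {s t T : ℝ≥0} (hs : s ≤ T) (ht : t ≤ T) (i k : V) :
    cov[fun ω => X s ω i, fun ω => X t ω k; P] =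
      ∑ j, ∫ x in (0 : ℝ)..T, (∫ r in x..(T : ℝ), g s i j r) * ∫ r in x..(T : ℝ), g t k j r := by
  have hds : ∀ j, IntervalIntegrable (g s i j) volume 0 T := fun j => hg s i j T
  have hdt : ∀ j, IntervalIntegrable (g t k j) volume 0 T := fun j => hg t k j T
  have h1 : (fun ω => X s ω i) =ᵐ[P]
      fun ω => m s i + ∑ j, ∫ x in (0 : ℝ)..T, W x.toNNReal ω j * g s i j x := by
    filter_upwards [hX T] with ω hω using hω s hs i
  have h2 : (fun ω => X t ω k) =ᵐ[P]
      fun ω => m t k + ∑ j, ∫ x in (0 : ℝ)..T, W x.toNNReal ω j * g t k j x := by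
    filter_upwards [hX T] with ω hω using hω t ht k
  rw [covariance_congr_ae h1 h2,
    covariance_const_add_left ((hW.memLp_integral T hds).integrable one_le_two),
    covariance_const_add_right ((hW.memLp_integral T hdt).integrable one_le_two),
    hW.covariance_integral T hds hdt]

end GaussianSolution

end SWEK

namespace SWEK

/-! ### The covariance kernel -/

section Kernel

open Matrix Set

lemma integral_sin_mul_sin {θ : ℝ} (hθ : θ ≠ 0) (s t : ℝ) :
    ∫ x in (0 : ℝ)..min t s, (Real.sin ((s - x) * θ) / θ) * (Real.sin ((t - x) * θ) / θ) =
      θ⁻¹ ^ 2 * (1 / 2 * min t s * Real.cos ((t - s) * θ) -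
        1 / 2 * (Real.cos (max t s * θ) * Real.sin (min t s * θ) * θ⁻¹)) := by
  wlog hst : s ≤ t generalizing s t
  · have := this t s (le_of_not_ge hst)
    have hcos : Real.cos ((t - s) * θ) = Real.cos ((s - t) * θ) := by
      rw [← Real.cos_neg]; ring_nf
    rw [min_comm t s, max_comm t s, hcos, ← this]
    simp only [mul_comm]
  rw [min_eq_right hst, max_eq_left hst]
  -- Product-to-sum: the integrand is `(cos ((t - s) θ) - cos ((s + t - 2 x) θ)) / (2 θ²)`.
  have hF : ∀ x ∈ uIcc (0 : ℝ) s, HasDerivAt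
      (fun x => θ⁻¹ ^ 2 * (1 / 2 * x * Real.cos ((t - s) * θ) +
        1 / 4 * (Real.sin ((s - x) * θ + (t - x) * θ) * θ⁻¹)))
      ((Real.sin ((s - x) * θ) / θ) * (Real.sin ((t - x) * θ) / θ)) x := by
    intro x _
    have h1 : HasDerivAt (fun x : ℝ => (s - x) * θ + (t - x) * θ) (-1 * θ + -1 * θ) x :=
      (((hasDerivAt_id x).const_sub s).mul_const θ).add
        (((hasDerivAt_id x).const_sub t).mul_const θ)
    have h2 := (((((hasDerivAt_id x).const_mul (1 / 2)).mul_const (Real.cos ((t - s) * θ))).add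
      ((h1.sin.mul_const θ⁻¹).const_mul (1 / 4))).const_mul (θ⁻¹ ^ 2))
    refine h2.congr_deriv ?_
    have h3 : (t - s) * θ = (t - x) * θ - (s - x) * θ := by ring
    rw [h3, Real.cos_sub, Real.cos_add]
    field_simp
    ring
  rw [intervalIntegral.integral_eq_sub_of_hasDerivAt hF
    (Continuous.intervalIntegrable (by fun_prop) _ _)]
  have e1 : (s - s) * θ + (t - s) * θ = t * θ - s * θ := by ring
  have e2 : (s - 0) * θ + (t - 0) * θ = t * θ + s * θ := by ring
  rw [e1, e2, Real.sin_sub, Real.sin_add]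
  ring

variable {V : Type*} [Fintype V] [DecidableEq V] {U : Matrix V V ℝ}

/-- The density against the noise path: `σ 1_{r ≤ t} cos(Θ (t - r))`. The cut-off makes integrals
up to different times `t` integrals over one common interval. -/
noncomputable def noiseWeight (U : Matrix V V ℝ) (θ : V → ℝ) (σ : ℝ) (t : ℝ≥0) (i j : V) (r : ℝ) :
    ℝ :=
  indicator {r : ℝ | r ≤ t} (fun r => σ * conjDiag U (fun k => Real.cos ((t - r) * θ k)) i j) r

lemma continuous_conjDiag_apply (hU : Uᵀ * U = 1) {f : ℝ → V → ℝ}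
    (hf : ∀ k, Continuous fun r => f r k) (i j : V) : Continuous fun r => conjDiag U (f r) i j := by
  simp only [conjDiag_apply hU]
  fun_prop

lemma intervalIntegrable_noiseWeight (hU : Uᵀ * U = 1) (θ : V → ℝ) (σ : ℝ) (t : ℝ≥0) (i j : V)
    (a b : ℝ) : IntervalIntegrable (noiseWeight U θ σ t i j) volume a b := by
  have hc : Continuous fun r => σ * conjDiag U (fun k => Real.cos ((t - r) * θ k)) i j :=
    continuous_const.mul (continuous_conjDiag_apply hU (fun k => by fun_prop) i j)
  have h := hc.intervalIntegrable (μ := volume) a b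
  exact ⟨h.1.indicator measurableSet_Iic, h.2.indicator measurableSet_Iic⟩

/-- The primitive of the noise weight is `σ Θ⁻¹ sin(Θ (t - x)⁺)`. -/
lemma integral_noiseWeight (hU : Uᵀ * U = 1) {θ : V → ℝ} (hθ : ∀ k, θ k ≠ 0) (σ : ℝ)
    {t T : ℝ≥0} (ht : t ≤ T) (i j : V) {x : ℝ} (hx : x ≤ T) :
    ∫ r in x..(T : ℝ), noiseWeight U θ σ t i j r =
      σ * conjDiag U (fun k => Real.sin (max (t - x) 0 * θ k) / θ k) i j := by
  have htT : (t : ℝ) ≤ T := ht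
  unfold noiseWeight
  rcases le_total x t with hxt | hxt
  · rw [intervalIntegral.integral_indicator ⟨hxt, htT⟩, max_eq_left (by linarith)]
    have hd : ∀ r ∈ uIcc x (t : ℝ), HasDerivAt
        (fun r => -σ * ∑ k, U k i * (Real.sin ((t - r) * θ k) / θ k) * U k j)
        (σ * conjDiag U (fun k => Real.cos ((t - r) * θ k)) i j) r := by
      intro r _
      have h1 : ∀ k, HasDerivAt (fun r => U k i * (Real.sin ((t - r) * θ k) / θ k) * U k j)
          (U k i * (Real.cos ((t - r) * θ k) * (-1 * θ k) / θ k) * U k j) r := fun k => by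
        have hl : HasDerivAt (fun r : ℝ => ((t : ℝ) - r) * θ k) (-1 * θ k) r :=
          ((hasDerivAt_id r).const_sub (t : ℝ)).mul_const _
        exact ((hl.sin.div_const _).const_mul _).mul_const _
      refine ((HasDerivAt.fun_sum fun k _ => h1 k).const_mul (-σ)).congr_deriv ?_
      rw [conjDiag_apply hU, Finset.mul_sum, Finset.mul_sum]
      refine Finset.sum_congr rfl fun k _ => ?_
      have := hθ k
      field_simp
    rw [intervalIntegral.integral_eq_sub_of_hasDerivAt hd
      ((continuous_const.mul
        (continuous_conjDiag_apply hU (fun k => by fun_prop) i j)).intervalIntegrable _ _),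
      conjDiag_apply hU]
    simp
  · rw [max_eq_right (by linarith)]
    have h0 : ∫ r in x..(T : ℝ), indicator {r : ℝ | r ≤ t}
        (fun r => σ * conjDiag U (fun k => Real.cos ((t - r) * θ k)) i j) r
        = ∫ r in x..(T : ℝ), (0 : ℝ) := by
      refine intervalIntegral.integral_congr_ae (.of_forall fun r hr => ?_)
      rw [uIoc_of_le hx] at hr
      exact indicator_of_notMem (by simpa using hxt.trans_lt hr.1) _
    rw [h0, conjDiag_apply hU]
    simp

/-- The Itô isometry for the primitives of the noise weights gives the kernel. -/
lemma sum_integral_eq_kernel (hU : Uᵀ * U = 1) {lam : V → ℝ} (hlam : ∀ k, 0 < lam k)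
    {c : ℝ} (hc : c ≠ 0) (σ : ℝ) {A : Matrix V V ℝ} (hA : IsSelfAdjoint A) (h : A = conjDiag U lam)
    {s t T : ℝ≥0} (hs : s ≤ T) (ht : t ≤ T) (i l : V) :
    ∑ j, ∫ x in (0 : ℝ)..T,
      (∫ r in x..(T : ℝ), noiseWeight U (fun k => c * √(lam k)) σ s i j r) *
        ∫ r in x..(T : ℝ), noiseWeight U (fun k => c * √(lam k)) σ t l j r
      = kernel c σ A s t i l := by
  have hθ : ∀ k, c * √(lam k) ≠ 0 := fun k => mul_ne_zero hc (Real.sqrt_pos.2 (hlam k)).ne'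
  rw [kernel_eq_conjDiag (isUnit_of_orthogonal hU) hA h hθ]
  set θ : V → ℝ := fun k => c * √(lam k) with hθdef
  set S : ℝ≥0 → ℝ → V → ℝ := fun t x k => Real.sin (max (t - x) 0 * θ k) / θ k with hS
  have hSc : ∀ t k, Continuous fun x => S t x k := fun t k => by simp only [hS]; fun_prop
  have h1 : ∀ j, ∫ x in (0 : ℝ)..T, (∫ r in x..(T : ℝ), noiseWeight U θ σ s i j r) *
        (∫ r in x..(T : ℝ), noiseWeight U θ σ t l j r)
      = ∫ x in (0 : ℝ)..T, σ ^ 2 * (conjDiag U (S s x) i j * conjDiag U (S t x) j l) := by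
    intro j
    refine intervalIntegral.integral_congr fun x hx => ?_
    rw [uIcc_of_le T.coe_nonneg] at hx
    rw [integral_noiseWeight hU hθ σ hs i j hx.2, integral_noiseWeight hU hθ σ ht l j hx.2,
      conjDiag_symm hU _ l j]
    ring
  simp only [h1]
  have hc1 : ∀ j, Continuous fun x =>
      σ ^ 2 * (conjDiag U (S s x) i j * conjDiag U (S t x) j l) := fun j =>
    continuous_const.mul ((continuous_conjDiag_apply hU (hSc s) i j).mul
      (continuous_conjDiag_apply hU (hSc t) j l))
  rw [← intervalIntegral.integral_finsetSum fun j _ => (hc1 j).intervalIntegrable _ _]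
  have hprod : ∀ x, ∑ j, σ ^ 2 * (conjDiag U (S s x) i j * conjDiag U (S t x) j l)
      = ∑ k, σ ^ 2 * (U k i * (S s x k * S t x k) * U k l) := fun x => by
    rw [← Finset.mul_sum, ← mul_apply, conjDiag_mul (isUnit_of_orthogonal hU), conjDiag_apply hU,
      Finset.mul_sum]
  simp_rw [hprod]
  rw [conjDiag_apply hU]
  have hc2 : ∀ k, Continuous fun x => σ ^ 2 * (U k i * (S s x k * S t x k) * U k l) := fun k =>
    continuous_const.mul ((continuous_const.mul ((hSc s k).mul (hSc t k))).mul continuous_const)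
  rw [intervalIntegral.integral_finsetSum fun k _ => (hc2 k).intervalIntegrable _ _]
  refine Finset.sum_congr rfl fun k _ => ?_
  rw [intervalIntegral.integral_const_mul, intervalIntegral.integral_mul_const,
    intervalIntegral.integral_const_mul]
  have hmT : min (t : ℝ) s ≤ T := (min_le_left _ _).trans ht
  have hm0 : 0 ≤ min (t : ℝ) s := le_min t.coe_nonneg s.coe_nonneg
  have hcont : Continuous fun x => S s x k * S t x k := (hSc s k).mul (hSc t k)
  -- Beyond `min t s` one of the two factors vanishes.
  have h2 : ∫ x in (0 : ℝ)..T, S s x k * S t x k = ∫ x in (0 : ℝ)..min (t : ℝ) s,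
      (Real.sin ((s - x) * θ k) / θ k) * (Real.sin ((t - x) * θ k) / θ k) := by
    rw [← intervalIntegral.integral_add_adjacent_intervals
      (hcont.intervalIntegrable 0 (min (t : ℝ) s)) (hcont.intervalIntegrable _ _)]
    have h3 : ∫ x in (min (t : ℝ) s)..T, S s x k * S t x k
        = ∫ x in (min (t : ℝ) s)..T, (0 : ℝ) := by
      refine intervalIntegral.integral_congr fun x hx => ?_
      rw [uIcc_of_le hmT] at hx
      rcases min_le_iff.1 hx.1 with h | h <;> simp [hS, h]
    rw [h3, intervalIntegral.integral_zero, add_zero]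
    refine intervalIntegral.integral_congr fun x hx => ?_
    rw [uIcc_of_le hm0] at hx
    have hxs : x ≤ s := hx.2.trans (min_le_right _ _)
    have hxt : x ≤ t := hx.2.trans (min_le_left _ _)
    simp only [hS]
    rw [max_eq_left (by linarith), max_eq_left (by linarith)]
  rw [h2, integral_sin_mul_sin (hθ k)]
  ring

end Kernel

/-! ### The stochastic equation -/

section Equation

open Matrix

variable {Ω : Type*} [MeasurableSpace Ω] {P : Measure Ω} {V : Type*} [Fintype V] [DecidableEq V]
  {W : ℝ≥0 → Ω → EuclideanSpace ℝ V} {U : Matrix V V ℝ}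

/-- `IsSolution` asks no measurability in `ω`, so the solution can be chosen path by path. -/
lemma exists_isSolution (hW : IsBrownian W P) (hU : Uᵀ * U = 1) (hU' : U * Uᵀ = 1) {lam : V → ℝ}
    (hlam : ∀ k, 0 < lam k) {c : ℝ} (hc : c ≠ 0) (σ : ℝ) (u₀ v₀ : EuclideanSpace ℝ V) :
    ∃ u, IsSolution c σ (conjDiag U lam) W u₀ v₀ P u := by
  choose u v hu hv h using fun ω : {ω // Continuous fun t => W t ω} =>
    exists_pathSolution hU hU' hlam hc σ u₀ v₀ ω.2
  classical
  refine ⟨fun t ω => if hω : Continuous fun t => W t ω then u ⟨ω, hω⟩ t else 0,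
    fun t ω => if hω : Continuous fun t => W t ω then v ⟨ω, hω⟩ t else 0, ?_⟩
  filter_upwards [hW.ae_continuous] with ω hω
  simp only [dif_pos hω]
  exact ⟨hu _, hv _, h _⟩

/-- The representation of all values up to time `T` by integrals over the common interval `[0, T]`,
to which the results on Wiener integrals apply. -/
lemma IsSolution.ae_eq_mean_add (hW : IsBrownian W P) (hU : Uᵀ * U = 1) (hU' : U * Uᵀ = 1)
    {lam : V → ℝ} (hlam : ∀ k, 0 < lam k) {c : ℝ} (hc : c ≠ 0) {σ : ℝ} {A : Matrix V V ℝ}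
    (hA : IsSelfAdjoint A) (h : A = conjDiag U lam) {u₀ v₀ : EuclideanSpace ℝ V}
    {u : ℝ≥0 → Ω → EuclideanSpace ℝ V} (hsol : IsSolution c σ A W u₀ v₀ P u) (T : ℝ≥0) :
    ∀ᵐ ω ∂P, ∀ t ≤ T, ∀ i, u t ω i = mean c A u₀ v₀ t i + ∑ j, ∫ r in (0 : ℝ)..T,
      W r.toNNReal ω j * noiseWeight U (fun k => c * √(lam k)) σ t i j r := by
  obtain ⟨v, hv⟩ := hsol
  filter_upwards [hv, hW.ae_continuous] with ω ⟨huc, hvc, heq⟩ hWc t ht i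
  rw [pathSolution_eq hU hU' hlam hc σ hA h u₀ v₀ hWc huc hvc heq t i, Finset.mul_sum]
  congr 1
  refine Finset.sum_congr rfl fun j _ => ?_
  rw [← intervalIntegral.integral_const_mul,
    ← intervalIntegral.integral_indicator (a₃ := (T : ℝ)) ⟨t.coe_nonneg, ht⟩]
  refine intervalIntegral.integral_congr fun r _ => ?_
  simp only [noiseWeight, Set.indicator_apply]
  split_ifs
  · ring
  · ring

lemma IsSolution.ae_eq (hW : IsBrownian W P) (hU : Uᵀ * U = 1) (hU' : U * Uᵀ = 1)
    {lam : V → ℝ} (hlam : ∀ k, 0 < lam k) {c : ℝ} (hc : c ≠ 0) {σ : ℝ} {A : Matrix V V ℝ}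
    (hA : IsSelfAdjoint A) (h : A = conjDiag U lam) {u₀ v₀ : EuclideanSpace ℝ V}
    {u u' : ℝ≥0 → Ω → EuclideanSpace ℝ V} (hu : IsSolution c σ A W u₀ v₀ P u)
    (hu' : IsSolution c σ A W u₀ v₀ P u') : ∀ᵐ ω ∂P, ∀ t, u t ω = u' t ω := by
  obtain ⟨v, hv⟩ := hu
  obtain ⟨v', hv'⟩ := hu'
  filter_upwards [hv, hv', hW.ae_continuous] with ω ⟨huc, hvc, heq⟩ ⟨huc', hvc', heq'⟩ hWc t
  ext i
  rw [pathSolution_eq hU hU' hlam hc σ hA h u₀ v₀ hWc huc hvc heq t i,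
    pathSolution_eq hU hU' hlam hc σ hA h u₀ v₀ hWc huc' hvc' heq' t i]

end Equation

end SWEK

theorem mainTheorem2 {V : Type*} [Fintype V] [DecidableEq V] (G : WeightedGraph V)
    (L : Matrix V V ℝ) (hL : L = G.laplacian ∨ L = G.normalizedLaplacian)
    (ν κ c σ : ℝ) (hν : 0 < ν) (hκ : 0 < κ) (hc : c ≠ 0)
    {Ω : Type*} [MeasurableSpace Ω] (P : Measure Ω) [IsProbabilityMeasure P]
    (W : ℝ≥0 → Ω → EuclideanSpace ℝ V) (hW : SWEK.IsBrownian W P)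
    (u₀ v₀ : EuclideanSpace ℝ V) :
    (∃ u, SWEK.IsSolution c σ (SWEK.fracLaplacian ν κ L) W u₀ v₀ P u) ∧
    (∀ u u', SWEK.IsSolution c σ (SWEK.fracLaplacian ν κ L) W u₀ v₀ P u →
      SWEK.IsSolution c σ (SWEK.fracLaplacian ν κ L) W u₀ v₀ P u' →
      ∀ᵐ ω ∂P, ∀ t, u t ω = u' t ω) ∧
    (∀ u, SWEK.IsSolution c σ (SWEK.fracLaplacian ν κ L) W u₀ v₀ P u →
      IsGaussianProcess u P ∧
      (∀ t : ℝ≥0, ∫ ω, u t ω ∂P = SWEK.mean c (SWEK.fracLaplacian ν κ L) u₀ v₀ t) ∧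
      (∀ (U : Matrix V V ℝ) (lam : V → ℝ), IsUnit U →
        SWEK.fracLaplacian ν κ L = U⁻¹ * Matrix.diagonal lam * U →
        ∀ t : ℝ≥0, ∫ ω, u t ω ∂P = SWEK.meanDiag c U lam u₀ v₀ t) ∧
      (∀ s t : ℝ≥0,
        Matrix.of (fun i j : V => cov[fun ω => u s ω i, fun ω => u t ω j; P]) =
          SWEK.kernel c σ (SWEK.fracLaplacian ν κ L) s t)) := by
  have hLpos : L.PosSemidef := by
    rcases hL with rfl | rfl
    exacts [SWEK.posSemidef_laplacian G, SWEK.posSemidef_normalizedLaplacian G]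
  obtain ⟨hA, U, lam, hU, hU', hlam, h⟩ := SWEK.exists_diagonalization_fracLaplacian hLpos hν hκ
  refine ⟨?_, fun u u' hu hu' => hu.ae_eq hW hU hU' hlam hc hA h hu', fun u hu => ?_⟩
  · rw [h]
    exact SWEK.exists_isSolution hW hU hU' hlam hc σ u₀ v₀
  have hg : ∀ (t : ℝ≥0) i j (T : ℝ≥0), IntervalIntegrable
      (SWEK.noiseWeight U (fun k => c * √(lam k)) σ t i j) volume 0 T := fun t i j T =>
    SWEK.intervalIntegrable_noiseWeight hU _ σ t i j 0 T
  have hrep := hu.ae_eq_mean_add hW hU hU' hlam hc hA h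
  have hmean := hW.integral_of_eq_integral hg hrep
  refine ⟨hW.isGaussianProcess_of_eq_integral hg hrep, hmean, fun Q mu hQ hdiag t => ?_,
    fun s t => ?_⟩
  · rw [hmean, SWEK.mean_eq_meanDiag hQ hA hdiag]
  · ext i l
    rw [Matrix.of_apply, hW.covariance_of_eq_integral hg hrep (le_max_left s t) (le_max_right s t),
      SWEK.sum_integral_eq_kernel hU hlam hc σ hA h (le_max_left s t) (le_max_right s t)]
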